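/- **Theorem.** Fix $p\in(0,1)$, let $q=1-p$, and let $\Xi=\xi_1\xi_2\cdots$ be an infinite random string whose letters $\xi_i\in\{0,1\}$ are i.i.d. with $\mathbb P(\xi_i=1)=p$ and $\mathbb P(\xi_i=0)=q$. For a finite string $\alpha=\alpha_1\cdots\alpha_n$ let $P(\alpha)=\prod_{i=1}^n p^{\alpha_i}q^{1-\alpha_i}$. A *Tunstall code with $M\ge1$ phrases* is a set of finite strings (phrases) obtained by starting with the empty phrase only and then, $M-1$ times, replacing a phrase $\alpha$ with maximal $P(\alpha)$ by its two children $\alpha0$ and $\alpha1$ (ties are broken arbitrarily). Every infinite string has exactly one prefix in such a code. For every $M\ge1$ choose a Tunstall code with $M$ phrases, and let $D^T_M$ be the length of the unique phrase in it that is a prefix of $\Xi$. Let $$H=-p\ln p-q\ln q,\qquad H_2=p\ln^2p+q\ln^2q,\qquad \sigma^2=H_2-H^2=pq\ln^2(p/q).$$ Then, as $M\to\infty$: 1. $D^T_M/\ln M\to 1/H$ almost surely. 2. $\dfrac{D^T_M-\ln M/H}{\sqrt{\ln M}}$ converges in distribution to $N(0,\sigma^2/H^3)$ (the point mass at $0$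 if $p=1/2$); thus, if $p\ne1/2$, then $D^T_M\sim\mathrm{AsN}\bigl(\frac{\ln M}{H},\frac{\sigma^2}{H^3}\ln M\bigr)$, i.e. $\dfrac{D^T_M-\ln M/H}{\sqrt{(\sigma^2/H^3)\ln M}}$ converges in distribution to $N(0,1)$. 3. $\operatorname{Var}D^T_M=\frac{\sigma^2}{H^3}\ln M+o(\ln M)$; thus, if $p\neq1/2$, then $\operatorname{Var}D^T_M\sim\frac{\sigma^2}{H^3}\ln M$. 4. If $\ln p/\ln q$ is irrational, then $$\mathbb E D^T_M=\frac{\ln M}{H}+\frac{\ln H}{H}+\frac{H_2}{2H^2}+o(1).$$ 5. If $\ln p/\ln q$ is rational, let $d=\gcd(\ln p,\ln q)$ be the largest positive real number such that $\ln p$ and $\ln q$ both are integer multiples of $d$. Then $$\mathbb E D^T_M=\frac{\ln M}{H}+\frac{\ln H}{H}+\frac{H_2}{2H^2}+\frac1H\ln\frac{\sinh(d/2)}{d/2}+\frac dH\,\psi\!\left(\left\{\frac{\ln M+\ln\bigl(H(1-e^{-d})/d\bigr)}{d}\right\}\right)+o(1),$$ where $\{\cdot\}$ denotes the fractional part and $\psi(x)=\dfrac{e^{dx}-1}{e^d-1}-x$.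 -/

import Mathlib

open MeasureTheory ProbabilityTheory Filter Topology Asymptotics

namespace Tunstall

noncomputable section

/-- Probability of a single letter: `P(1) = p`, `P(0) = q = 1 - p` (`true` is the letter `1`). -/
def letterProb (p : ℝ) (a : Bool) : ℝ := if a then p else 1 - p

/-- `P(α₁⋯αₙ) = ∏ P(αᵢ)`, the probability that a random infinite string begins with `α₁⋯αₙ`. -/
def wordProb (p : ℝ) (α : List Bool) : ℝ := (α.map (letterProb p)).prod

/-- The entropy `H = -p ln p - q ln q` of a letter. -/
def entropy (p : ℝ) : ℝ := -p * Real.log p - (1 - p) * Real.log (1 - p)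

/-- `H₂ = p ln² p + q ln² q`. -/
def entropy₂ (p : ℝ) : ℝ := p * Real.log p ^ 2 + (1 - p) * Real.log (1 - p) ^ 2

/-- `σ² = H₂ - H²`. -/
def sigmaSq (p : ℝ) : ℝ := entropy₂ p - entropy p ^ 2

theorem sigmaSq_eq {p : ℝ} (hp₀ : 0 < p) (hp₁ : p < 1) :
    sigmaSq p = p * (1 - p) * Real.log (p / (1 - p)) ^ 2 := by
  rw [Real.log_div hp₀.ne' (by linarith)]
  unfold sigmaSq entropy₂ entropy
  ring

/-- `IsTunstallCode p M D`: the set of phrases `D` can be obtained by Tunstall's construction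
with `M` phrases, that is, by starting with the empty phrase only and replacing `M - 1` times a
phrase `α` of maximal probability by its two children `α0` and `α1`. Ties are broken
arbitrarily. -/
inductive IsTunstallCode (p : ℝ) : ℕ → Finset (List Bool) → Prop
  | init : IsTunstallCode p 1 {[]}
  | step {M : ℕ} {D : Finset (List Bool)} {α : List Bool} (hD : IsTunstallCode p M D)
      (hα : α ∈ D) (hmax : ∀ β ∈ D, wordProb p β ≤ wordProb p α) :
      IsTunstallCode p (M + 1)
        (insert (α ++ [false]) (insert (α ++ [true]) (D.erase α)))

/-- The string of the first `n` letters of the infinite string `x`. -/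
def firstLetters (x : ℕ → Bool) (n : ℕ) : List Bool := (List.range n).map x

theorem firstLetters_succ (x : ℕ → Bool) (n : ℕ) :
    firstLetters x (n + 1) = firstLetters x n ++ [x n] := by
  simp [firstLetters, List.range_succ]

@[simp] theorem length_firstLetters (x : ℕ → Bool) (n : ℕ) :
    (firstLetters x n).length = n := by
  simp [firstLetters]

/-- The length of the first phrase of the infinite string `x`, when `x` is parsed with the
dictionary `D`: the length of the prefix of `x` that belongs to `D`. For a Tunstall code this
prefix exists and is unique, see `IsTunstallCode.existsUnique_prefix`. -/
def phraseLength (D : Finset (List Bool)) (x : ℕ → Bool) : ℕ :=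
  sInf {n | firstLetters x n ∈ D}

/-- The length of a phrase is bounded, so that all its moments are finite. -/
theorem phraseLength_le (D : Finset (List Bool)) (x : ℕ → Bool) :
    phraseLength D x ≤ D.sup List.length := by
  unfold phraseLength
  rcases Set.eq_empty_or_nonempty {n | firstLetters x n ∈ D} with h | h
  · simp [h]
  · simpa using Finset.le_sup (f := List.length) (Nat.sInf_mem h)

theorem IsTunstallCode.existsUnique_prefix {p : ℝ} {M : ℕ} {D : Finset (List Bool)}
    (h : IsTunstallCode p M D) (x : ℕ → Bool) : ∃! n, firstLetters x n ∈ D := by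
  induction h with
  | init =>
    refine ⟨0, by simp [firstLetters], fun m hm => ?_⟩
    have := congrArg List.length (Finset.mem_singleton.1 hm)
    simpa using this
  | @step M D α hD hα hmax ih =>
    obtain ⟨n, hn, huniq⟩ := ih
    have key : ∀ m b, firstLetters x m = α ++ [b] → m = n + 1 ∧ firstLetters x n = α := by
      intro m b hm
      cases m with
      | zero => simp [firstLetters] at hm
      | succ k =>
        rw [firstLetters_succ] at hm
        have hk := (List.append_inj' hm rfl).1
        have : k = n := huniq k (by simpa only [hk] using hα)
        subst this
        exact ⟨rfl, hk⟩
    by_cases hx : firstLetters x n = α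
    · refine ⟨n + 1, ?_, fun m hm => ?_⟩
      · simp only [firstLetters_succ, hx]
        cases x n <;> simp
      · simp only [Finset.mem_insert, Finset.mem_erase] at hm
        rcases hm with hm | hm | ⟨hne, hm⟩
        · exact (key m _ hm).1
        · exact (key m _ hm).1
        · exact absurd (by rw [huniq m hm, hx]) hne
    · refine ⟨n, by simp [hx, hn], fun m hm => ?_⟩
      simp only [Finset.mem_insert, Finset.mem_erase] at hm
      rcases hm with hm | hm | ⟨_, hm⟩
      · exact absurd (key m _ hm).2 hx
      · exact absurd (key m _ hm).2 hx
      · exact huniq m hm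

/-- The positive reals `d` such that `x` and `y` both are integer multiples of `d`. -/
def commonDivisors (x y : ℝ) : Set ℝ :=
  {d | 0 < d ∧ (∃ k : ℤ, x = k * d) ∧ ∃ l : ℤ, y = l * d}

/-- `d = gcd(ln p, ln q)`, the largest positive real such that `ln p` and `ln q` both are integer
multiples of `d`. It is used only when `ln p / ln q` is rational, when such a largest number
exists, see `isGreatest_span`. -/
def span (p : ℝ) : ℝ := sSup (commonDivisors (Real.log p) (Real.log (1 - p)))

theorem isGreatest_span {p : ℝ} (hp₀ : 0 < p) (hp₁ : p < 1)
    (h : ¬ Irrational (Real.log p / Real.log (1 - p))) :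
    IsGreatest (commonDivisors (Real.log p) (Real.log (1 - p))) (span p) := by
  have hx : Real.log p < 0 := Real.log_neg hp₀ hp₁
  have hy : Real.log (1 - p) < 0 := Real.log_neg (by linarith) (by linarith)
  unfold span
  generalize Real.log p = x at *
  generalize Real.log (1 - p) = y at *
  simp only [Irrational, not_not] at h
  obtain ⟨r, hr⟩ := h
  have hrpos : 0 < r := by
    have : (0 : ℝ) < r := by rw [hr]; exact div_pos_of_neg_of_neg hx hy
    exact_mod_cast this
  have hnum : 0 < r.num := Rat.num_pos.2 hrpos
  have hnumR : (0 : ℝ) < r.num := by exact_mod_cast hnum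
  have hdenR : (0 : ℝ) < r.den := by exact_mod_cast r.pos
  have hxy : x * r.den = y * r.num := by
    rw [Rat.cast_def, div_eq_div_iff hdenR.ne' hy.ne] at hr
    linarith
  have hmax : IsGreatest (commonDivisors x y) (-x / r.num) := by
    refine ⟨⟨div_pos (by linarith) hnumR, ⟨-r.num, ?_⟩, ⟨-r.den, ?_⟩⟩, ?_⟩
    · push_cast; field_simp
    · push_cast; field_simp; linarith
    · rintro d ⟨hd, ⟨k, hk⟩, ⟨l, hl⟩⟩
      have hkl : k * r.den = l * r.num := by
        have : (k : ℝ) * r.den = l * r.num := by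
          rw [hk, hl] at hxy
          have : d * (k * r.den) = d * (l * r.num) := by linarith
          exact mul_left_cancel₀ hd.ne' this
        exact_mod_cast this
      have hdvd : r.num ∣ k := by
        have hc : IsCoprime r.num (r.den : ℤ) := by
          rw [Int.isCoprime_iff_gcd_eq_one]
          exact r.reduced
        exact hc.dvd_of_dvd_mul_right ⟨l, by rw [hkl]; ring⟩
      have hkneg : (k : ℝ) < 0 := by
        by_contra hc
        push Not at hc
        have := mul_nonneg hc hd.le
        linarith
      have hkneg' : 0 < -k := by
        have : k < 0 := by exact_mod_cast hkneg
        omega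
      have hle : r.num ≤ -k := Int.le_of_dvd hkneg' ((dvd_neg).2 hdvd)
      have hleR : (r.num : ℝ) ≤ -k := by exact_mod_cast hle
      rw [le_div_iff₀ hnumR, hk]
      nlinarith
  rwa [hmax.csSup_eq]

/-- `ψ(x) = (e^{dx} - 1)/(e^d - 1) - x`. -/
def psi (d x : ℝ) : ℝ := (Real.exp (d * x) - 1) / (Real.exp d - 1) - x

end

end Tunstall

open Tunstall

namespace Tunstall

noncomputable section

/-! Give a word the cost `-ln P`. A Tunstall code always splits a cheapest leaf, so up to ties its
internal nodes are the words of cost at most a threshold `t` (`IsTunstallCode.exists_isKhodak`), and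
every leaf has cost `ln M + O(1)`.

Mean. Put `a = -ln p`, `b = -ln q`, and let `N(t)` and `E(t)` be the number of leaves and the
expected depth of the tree whose internal nodes are all words of cost at most `t`. Splitting off the
first letter gives `N(t) = N(t-a) + N(t-b)` and `E(t) = 1 + p E(t-a) + q E(t-b)` for `t ≥ 0`. Since
`e^{-a} = p`, `e^{-b} = q` and `pa + qb = H`, both `e^{-τ} N` and `E - τ/H` solve the homogeneous
renewal equation, where `τ(t)` is `t` in the irrational case and `t` rounded down to the lattice
`dℤ` in the rational one. Such a solution converges (`IsHarmonicFrom.exists_tendsto`): a value near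
the limsup forces values near the limsup on a whole earlier window, and from there the maximum
principle carries the lower bound forward. The limit is read off a conserved integral
(`IsHarmonicFrom.mul_limit_eq`). Eliminating `t` between the asymptotics of `N` and `E` gives the
mean. In the rational case many words tie at the threshold; the code interpolates linearly between
two consecutive lattice thresholds, and this produces `ψ`.

Fluctuations. Let `S_n` be the cost of the first `n` letters. The strong law `S_n / n → H` along the
phrase, whose cost is `ln M + O(1)`, gives almost sure convergence. Wald's identities are instances
of one telescoping sum over the tree (`GrowsTree.sum_leaves`). The quadratic one gives the variance,
because `H` times the centred length differs from `H n - S_n` by a bounded amount. The exponential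
one, combined with the almost sure limit of the length and dominated convergence, gives the limiting
characteristic function. -/

/-- The cost `-ln P(b)` of a letter. -/
def letterCost (p : ℝ) (b : Bool) : ℝ := -Real.log (letterProb p b)

/-- The cost `-ln P(w)` of a word. -/
def wordCost (p : ℝ) (w : List Bool) : ℝ := (w.map (letterCost p)).sum

/-! ### Costs and probabilities of letters and words. -/

section Letters

variable {p : ℝ}

theorem letterProb_pos (hp₀ : 0 < p) (hp₁ : p < 1) (b : Bool) : 0 < letterProb p b := by
  cases b <;> simp [letterProb] <;> linarith

theorem letterProb_lt_one (hp₀ : 0 < p) (hp₁ : p < 1) (b : Bool) : letterProb p b < 1 := by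
  cases b <;> simp [letterProb] <;> linarith

theorem letterCost_pos (hp₀ : 0 < p) (hp₁ : p < 1) (b : Bool) : 0 < letterCost p b :=
  neg_pos.2 (Real.log_neg (letterProb_pos hp₀ hp₁ b) (letterProb_lt_one hp₀ hp₁ b))

theorem exp_neg_letterCost (hp₀ : 0 < p) (hp₁ : p < 1) (b : Bool) :
    Real.exp (-letterCost p b) = letterProb p b := by
  rw [letterCost, neg_neg, Real.exp_log (letterProb_pos hp₀ hp₁ b)]

theorem letterCost_true : letterCost p true = -Real.log p := by simp [letterCost, letterProb]

theorem letterCost_false : letterCost p false = -Real.log (1 - p) := by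
  simp [letterCost, letterProb]

theorem letterProb_true : letterProb p true = p := by simp [letterProb]

theorem letterProb_false : letterProb p false = 1 - p := by simp [letterProb]

theorem entropy_eq : entropy p = p * letterCost p true + (1 - p) * letterCost p false := by
  rw [letterCost_true, letterCost_false, entropy]; ring

theorem entropy₂_eq :
    entropy₂ p = p * letterCost p true ^ 2 + (1 - p) * letterCost p false ^ 2 := by
  rw [letterCost_true, letterCost_false, entropy₂]; ring

theorem entropy_pos (hp₀ : 0 < p) (hp₁ : p < 1) : 0 < entropy p := by
  rw [entropy_eq]
  have := mul_pos hp₀ (letterCost_pos hp₀ hp₁ true)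
  have := mul_pos (sub_pos.2 hp₁) (letterCost_pos hp₀ hp₁ false)
  linarith

@[simp] theorem wordCost_nil : wordCost p [] = 0 := by simp [wordCost]

@[simp] theorem wordCost_cons (b : Bool) (w : List Bool) :
    wordCost p (b :: w) = letterCost p b + wordCost p w := by simp [wordCost]

@[simp] theorem wordCost_append (v w : List Bool) :
    wordCost p (v ++ w) = wordCost p v + wordCost p w := by simp [wordCost]

@[simp] theorem wordProb_nil : wordProb p [] = 1 := by simp [wordProb]

@[simp] theorem wordProb_cons (b : Bool) (w : List Bool) :
    wordProb p (b :: w) = letterProb p b * wordProb p w := by simp [wordProb]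

@[simp] theorem wordProb_append (v w : List Bool) :
    wordProb p (v ++ w) = wordProb p v * wordProb p w := by simp [wordProb]

theorem wordProb_eq_exp (hp₀ : 0 < p) (hp₁ : p < 1) (w : List Bool) :
    wordProb p w = Real.exp (-wordCost p w) := by
  induction w with
  | nil => simp
  | cons b w ih =>
    rw [wordProb_cons, wordCost_cons, neg_add, Real.exp_add, ih, exp_neg_letterCost hp₀ hp₁]

theorem wordProb_pos (hp₀ : 0 < p) (hp₁ : p < 1) (w : List Bool) : 0 < wordProb p w := by
  rw [wordProb_eq_exp hp₀ hp₁]; exact Real.exp_pos _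

theorem wordProb_le_wordProb (hp₀ : 0 < p) (hp₁ : p < 1) {v w : List Bool} :
    wordProb p v ≤ wordProb p w ↔ wordCost p w ≤ wordCost p v := by
  rw [wordProb_eq_exp hp₀ hp₁, wordProb_eq_exp hp₀ hp₁, Real.exp_le_exp, neg_le_neg_iff]

theorem wordCost_nonneg (hp₀ : 0 < p) (hp₁ : p < 1) (w : List Bool) : 0 ≤ wordCost p w := by
  induction w with
  | nil => simp
  | cons b w ih => rw [wordCost_cons]; linarith [letterCost_pos hp₀ hp₁ b]

theorem length_mul_le_wordCost {m : ℝ} (hm : ∀ b, m ≤ letterCost p b) (w : List Bool) :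
    w.length * m ≤ wordCost p w := by
  induction w with
  | nil => simp
  | cons b w ih => rw [wordCost_cons, List.length_cons]; push_cast; linarith [hm b]

theorem wordCost_le_length_mul {m : ℝ} (hm : ∀ b, letterCost p b ≤ m) (w : List Bool) :
    wordCost p w ≤ w.length * m := by
  induction w with
  | nil => simp
  | cons b w ih => rw [wordCost_cons, List.length_cons]; push_cast; linarith [hm b]

end Letters

/-! ### Binary trees and Khodak's description of Tunstall codes. -/

/-- `I` is the set of internal nodes and `D` the set of leaves of a finite binary tree, grown from
the root by repeatedly splitting leaves. -/
inductive GrowsTree : Finset (List Bool) → Finset (List Bool) → Prop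
  | init : GrowsTree ∅ {[]}
  | step {I D : Finset (List Bool)} {α : List Bool} (h : GrowsTree I D) (hα : α ∈ D) :
      GrowsTree (insert α I) (insert (α ++ [false]) (insert (α ++ [true]) (D.erase α)))

namespace GrowsTree

variable {I D : Finset (List Bool)}

theorem disjoint_and_parent_mem (h : GrowsTree I D) :
    (∀ w ∈ D, w ∉ I) ∧ ∀ w b, w ++ [b] ∈ I ∨ w ++ [b] ∈ D → w ∈ I := by
  induction h with
  | init => simp
  | @step I D α h hα ih =>
    obtain ⟨hdis, hpar⟩ := ih
    have hαI : α ∉ I := hdis α hα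
    have hchild : ∀ b, α ++ [b] ∉ insert α I := fun b hb => by
      rcases Finset.mem_insert.1 hb with hb | hb
      · simp at hb
      · exact hαI (hpar α b (Or.inl hb))
    refine ⟨fun w hw => ?_, fun w b hw => ?_⟩
    · simp only [Finset.mem_insert, Finset.mem_erase] at hw
      rcases hw with rfl | rfl | ⟨hne, hw⟩
      · exact hchild _
      · exact hchild _
      · simp [hne, hdis w hw]
    · simp only [Finset.mem_insert, Finset.mem_erase] at hw ⊢
      rcases hw with (hw | hw) | hw | hw | ⟨-, hw⟩
      · exact Or.inr (hpar w b (Or.inr (hw ▸ hα)))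
      · exact Or.inr (hpar w b (Or.inl hw))
      · exact Or.inl (List.append_inj' hw rfl).1
      · exact Or.inl (List.append_inj' hw rfl).1
      · exact Or.inr (hpar w b (Or.inr hw))

theorem notMem_internal (h : GrowsTree I D) {w : List Bool} (hw : w ∈ D) : w ∉ I :=
  h.disjoint_and_parent_mem.1 w hw

theorem append_notMem (h : GrowsTree I D) {w : List Bool} (hw : w ∈ D) (b : Bool) :
    w ++ [b] ∉ D :=
  fun hb => h.notMem_internal hw (h.disjoint_and_parent_mem.2 w b (Or.inr hb))

/-- Completeness of the tree. It is used to show that a word cheaper than every leaf is internal: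
costs increase along extensions, so such a word has no leaf as a prefix. -/
theorem mem_or_exists_prefix (h : GrowsTree I D) (w : List Bool) :
    w ∈ I ∨ ∃ β ∈ D, β <+: w := by
  induction h with
  | init => simp
  | @step I D α h hα ih =>
    rcases ih with hw | ⟨β, hβ, hβw⟩
    · exact Or.inl (Finset.mem_insert_of_mem hw)
    · by_cases hβα : β = α
      · subst hβα
        obtain ⟨v, rfl⟩ := hβw
        cases v with
        | nil => simp
        | cons b v =>
          refine Or.inr ⟨β ++ [b], ?_, ⟨v, by simp⟩⟩
          cases b <;> simp
      · exact Or.inr ⟨β, by simp [hβα, hβ], hβw⟩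

/-- Splitting a leaf changes the sum over the leaves by `g` at that leaf, which at the same moment
becomes internal. The leaf count, the total probability, the mean depth and all of Wald's identities
are special cases. -/
theorem sum_leaves {E : Type*} [AddCommGroup E] (h : GrowsTree I D) {f g : List Bool → E}
    (hfg : ∀ w, f (w ++ [false]) + f (w ++ [true]) = f w + g w) :
    ∑ w ∈ D, f w = f [] + ∑ w ∈ I, g w := by
  induction h with
  | init => simp
  | @step I D α h hα ih =>
    rw [Finset.sum_insert, Finset.sum_insert, Finset.sum_insert (h.notMem_internal hα), ← add_assoc,
      hfg, add_right_comm, Finset.add_sum_erase _ _ hα, ih]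
    · abel
    · simp [h.append_notMem hα]
    · simp [h.append_notMem hα]

theorem card_leaves (h : GrowsTree I D) : D.card = I.card + 1 := by
  have := h.sum_leaves (f := fun _ => (1 : ℤ)) (g := fun _ => 1) (fun _ => rfl)
  simp at this
  omega

end GrowsTree

/-- Khodak's description of a Tunstall code: up to ties, the internal nodes are the words of
cost at most `t`. -/
structure IsKhodak (p : ℝ) (M : ℕ) (D I : Finset (List Bool)) (t : ℝ) : Prop where
  grows : GrowsTree I D
  card_leaves : D.card = M
  exists_wordCost : ∃ α, wordCost p α = t
  mem_internal : ∀ w, wordCost p w < t → w ∈ I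
  wordCost_le : ∀ w ∈ I, wordCost p w ≤ t
  le_wordCost : ∀ w ∈ D, t ≤ wordCost p w
  wordCost_leaf_le : ∀ w ∈ D, wordCost p w ≤ t + (letterCost p true + letterCost p false)

/-- Maximal probability is minimal cost, so the cost of the leaf split last serves as the threshold.
It never decreases, since every leaf costs at least the current threshold, and the two new leaves
exceed it by one letter cost. -/
theorem IsTunstallCode.exists_isKhodak {p : ℝ} (hp₀ : 0 < p) (hp₁ : p < 1) {M : ℕ}
    {D : Finset (List Bool)} (h : IsTunstallCode p M D) : ∃ I t, IsKhodak p M D I t := by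
  have ha := letterCost_pos hp₀ hp₁ true
  have hb := letterCost_pos hp₀ hp₁ false
  induction h with
  | init =>
    refine ⟨∅, 0, .init, by simp, ⟨[], by simp⟩, fun w hw => ?_, by simp, by simp, ?_⟩
    · exact absurd hw (wordCost_nonneg hp₀ hp₁ w).not_gt
    · simp; linarith
  | @step M D α hD hα hmax ih =>
    obtain ⟨I, t, hI⟩ := ih
    have hmax' : ∀ β ∈ D, wordCost p α ≤ wordCost p β := fun β hβ =>
      (wordProb_le_wordProb hp₀ hp₁).1 (hmax β hβ)
    have htα := hI.le_wordCost α hα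
    have hg := hI.grows.step hα
    refine ⟨_, wordCost p α, hg, ?_, ⟨α, rfl⟩, fun w hw => ?_, fun w hw => ?_, fun w hw => ?_,
      fun w hw => ?_⟩
    · rw [hg.card_leaves, Finset.card_insert_of_notMem (hI.grows.notMem_internal hα),
        ← hI.grows.card_leaves, hI.card_leaves]
    · rcases hI.grows.mem_or_exists_prefix w with hw' | ⟨β, hβ, v, rfl⟩
      · exact Finset.mem_insert_of_mem hw'
      · have := hmax' β hβ
        have := wordCost_nonneg hp₀ hp₁ v
        rw [wordCost_append] at hw
        linarith
    · rcases Finset.mem_insert.1 hw with rfl | hw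
      · exact le_rfl
      · exact (hI.wordCost_le w hw).trans htα
    · simp only [Finset.mem_insert, Finset.mem_erase] at hw
      rcases hw with rfl | rfl | ⟨-, hw⟩
      · simp [hb.le]
      · simp [ha.le]
      · exact hmax' w hw
    · simp only [Finset.mem_insert, Finset.mem_erase] at hw
      rcases hw with rfl | rfl | ⟨-, hw⟩
      · simp [ha.le]
      · simp [hb.le]
      · linarith [hI.wordCost_leaf_le w hw]

/-! ### The renewal theorem for a two-point distribution. -/

/-- `F` solves the homogeneous renewal equation for the two-point distribution `p δ_a + q δ_b`,
from time `T` on. -/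
structure IsHarmonicFrom (p q a b T : ℝ) (F : ℝ → ℝ) : Prop where
  p_pos : 0 < p
  q_pos : 0 < q
  add_eq : p + q = 1
  a_pos : 0 < a
  b_pos : 0 < b
  eq : ∀ t, T ≤ t → F t = p * F (t - a) + q * F (t - b)

namespace IsHarmonicFrom

variable {p q a b T : ℝ} {F : ℝ → ℝ}

theorem mono (h : IsHarmonicFrom p q a b T F) {T' : ℝ} (hT : T ≤ T') :
    IsHarmonicFrom p q a b T' F :=
  { h with eq := fun t ht => h.eq t (hT.trans ht) }

theorem neg (h : IsHarmonicFrom p q a b T F) : IsHarmonicFrom p q a b T (fun t => -F t) :=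
  { h with eq := fun t ht => by rw [h.eq t ht]; ring }

/-- Maximum principle: each value from time `T` on is a convex combination of two earlier ones. -/
theorem le_of_le (h : IsHarmonicFrom p q a b T F) {B : ℝ}
    (hB : ∀ t, T - (a + b) ≤ t → t < T → F t ≤ B) {t : ℝ} (ht : T - (a + b) ≤ t) : F t ≤ B := by
  have ha := h.a_pos
  have hb := h.b_pos
  have hm : 0 < min a b := lt_min ha hb
  -- Advancing by `min a b` keeps both `t - a` and `t - b` in the range already covered.
  have key : ∀ n : ℕ, ∀ t, T - (a + b) ≤ t → t < T + n * min a b → F t ≤ B := by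
    intro n
    induction n with
    | zero => simpa using hB
    | succ n ih =>
      intro t ht htn
      rcases lt_or_ge t T with htT | htT
      · exact hB t ht htT
      · push_cast at htn
        have h1 := ih (t - a) (by linarith) (by linarith [min_le_left a b])
        have h2 := ih (t - b) (by linarith) (by linarith [min_le_right a b])
        rw [h.eq t htT]
        calc p * F (t - a) + q * F (t - b) ≤ p * B + q * B :=
              add_le_add (mul_le_mul_of_nonneg_left h1 h.p_pos.le)
                (mul_le_mul_of_nonneg_left h2 h.q_pos.le)
          _ = B := by rw [← add_mul, h.add_eq, one_mul]
  obtain ⟨n, hn⟩ := exists_nat_gt ((t - T) / min a b)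
  rw [div_lt_iff₀ hm] at hn
  exact key n t ht (by linarith)

theorem ge_of_ge (h : IsHarmonicFrom p q a b T F) {B : ℝ}
    (hB : ∀ t, T - (a + b) ≤ t → t < T → B ≤ F t) {t : ℝ} (ht : T - (a + b) ≤ t) : B ≤ F t :=
  neg_le_neg_iff.1 (h.neg.le_of_le (B := -B) (fun s h1 h2 => neg_le_neg (hB s h1 h2)) ht)

/-- If `F` is close to an upper bound at `t`, then it is close to it at all earlier times that can
be reached by few steps. -/
theorem sub_pow_mul_le (h : IsHarmonicFrom p q a b T F) {s δ r : ℝ} (hr : 0 < r) (hrp : r ≤ p)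
    (hrq : r ≤ q) (hδ : 0 ≤ δ) (hs : ∀ t, T - (a + b) ≤ t → F t ≤ s + δ) {t : ℝ}
    (ht : s - δ ≤ F t) (i j : ℕ) (hij : T ≤ t - i * a - j * b) :
    s - (2 / r) ^ (i + j) * δ ≤ F (t - i * a - j * b) := by
  have ha := h.a_pos
  have hb := h.b_pos
  have hr2 : 0 < 2 / r := by positivity
  have hr1 : 1 ≤ 2 / r := by
    rw [le_div_iff₀ hr]; linarith [h.add_eq]
  -- One step back multiplies the deficit by at most `2 / r`. If `F (u - a)` were below `s - 2x/r`,
  -- its weight `p ≥ r` would cost at least `2x`, while the other term gains at most `q δ ≤ x`,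
  -- forcing `F u < s - x`. The same holds for `b`.
  have step : ∀ u x, T ≤ u → δ ≤ x → s - x ≤ F u →
      s - 2 / r * x ≤ F (u - a) ∧ s - 2 / r * x ≤ F (u - b) := by
    intro u x hu hx hFu
    have e := h.eq u hu
    have ha' := hs (u - a) (by linarith)
    have hb' := hs (u - b) (by linarith)
    have hpq := h.add_eq
    have hx0 : 0 ≤ x := hδ.trans hx
    have hq1 : q ≤ 1 := by linarith [h.p_pos]
    have hp1 : p ≤ 1 := by linarith [h.q_pos]
    have hrx : r * (2 / r * x) = 2 * x := by field_simp
    have hy : 0 ≤ 2 / r * x := by positivity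
    have hqδ : q * δ ≤ x := (mul_le_of_le_one_left hδ hq1).trans hx
    have hpδ : p * δ ≤ x := (mul_le_of_le_one_left hδ hp1).trans hx
    have hpqs : p * s + q * s = s := by rw [← add_mul, hpq, one_mul]
    generalize 2 / r * x = z at *
    constructor
    · by_contra hc
      push Not at hc
      have h1 := mul_lt_mul_of_pos_left hc h.p_pos
      have h2 := mul_le_mul_of_nonneg_left hb' h.q_pos.le
      have h3 := mul_le_mul_of_nonneg_right hrp hy
      linarith
    · by_contra hc
      push Not at hc
      have h1 := mul_lt_mul_of_pos_left hc h.q_pos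
      have h2 := mul_le_mul_of_nonneg_left ha' h.p_pos.le
      have h3 := mul_le_mul_of_nonneg_right hrq hy
      linarith
  induction i with
  | zero =>
    induction j with
    | zero => simpa using ht
    | succ j ih =>
      push_cast at hij ih ⊢
      have h1 : T ≤ t - 0 * a - j * b := by linarith
      have := (step _ _ h1 (le_mul_of_one_le_left hδ (one_le_pow₀ hr1)) (ih h1)).2
      rw [show t - 0 * a - (j + 1) * b = t - 0 * a - j * b - b by ring, ← add_assoc, pow_succ',
        mul_assoc]
      exact this
  | succ i ih =>
    push_cast at hij ih ⊢
    have h1 : T ≤ t - i * a - j * b := by linarith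
    have := (step _ _ h1 (le_mul_of_one_le_left hδ (one_le_pow₀ hr1)) (ih h1)).1
    rw [show t - (i + 1) * a - j * b = t - i * a - j * b - a by ring, add_right_comm, pow_succ',
      mul_assoc]
    exact this

/-- A bounded solution of the renewal equation converges, provided that it is controlled from
below at each time of a window of length `a + b` by its values at finitely many times that can be
reached from a single later time. -/
theorem exists_tendsto (h : IsHarmonicFrom p q a b 0 F) {B : ℝ}
    (hB : ∀ t, -(a + b) ≤ t → t < 0 → |F t| ≤ B)
    (happrox : ∀ ε > 0, ∃ (K : ℝ) (N : ℕ), ∀ t u, 0 ≤ u → t - K - (a + b) ≤ u → u ≤ t - K →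
      ∃ i ≤ N, ∃ j ≤ N, F (t - i * a - j * b) ≤ F u + ε) :
    ∃ l, Tendsto F atTop (𝓝 l) := by
  have ha := h.a_pos
  have hb := h.b_pos
  have hle : ∀ᶠ t in atTop, F t ≤ B := (eventually_ge_atTop 0).mono fun t ht =>
    h.le_of_le (fun s h1 h2 => (abs_le.1 (hB s (by linarith) h2)).2) (by linarith)
  have hge : ∀ᶠ t in atTop, -B ≤ F t := (eventually_ge_atTop 0).mono fun t ht =>
    h.ge_of_ge (fun s h1 h2 => (abs_le.1 (hB s (by linarith) h2)).1) (by linarith)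
  have hbdd : IsBoundedUnder (· ≤ ·) atTop F := ⟨B, by simpa using hle⟩
  have hcobdd : IsCoboundedUnder (· ≤ ·) atTop F :=
    IsBoundedUnder.isCoboundedUnder_le ⟨-B, by simpa using hge⟩
  set s := limsup F atTop with hs
  refine ⟨s, ?_⟩
  rw [Metric.tendsto_atTop']
  intro ε hε
  obtain ⟨K, N, hKN⟩ := happrox (ε / 4) (by positivity)
  set r := min p q with hr_def
  have hr : 0 < r := lt_min h.p_pos h.q_pos
  have hr1 : 1 ≤ 2 / r := by
    rw [le_div_iff₀ hr]; linarith [h.add_eq, min_le_left p q, h.q_pos]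
  -- At most `2N` backward steps are taken, each multiplying the deficit by `2 / r`, so it ends at
  -- `ε / 4` or less.
  set δ := ε / 4 / (2 / r) ^ (2 * N) with hδ_def
  have hδ : 0 < δ := by positivity
  have hδε : δ ≤ ε / 4 := div_le_self (by positivity) (one_le_pow₀ hr1)
  obtain ⟨T, hT⟩ := eventually_atTop.1 (eventually_lt_of_limsup_lt (f := atTop) (u := F)
    (show s < s + δ by linarith) hbdd)
  set T₀ := max T 0 + (a + b) with hT₀
  have hh : IsHarmonicFrom p q a b T₀ F := h.mono (by positivity)
  have hfreq := frequently_lt_of_lt_limsup (f := atTop) (u := F) hcobdd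
    (show s - δ < s by linarith)
  -- The time `t` nearly attains the limsup and is so late that `N` steps back of each kind stay
  -- past `T₀` and the window before `t - K` consists of nonnegative times.
  obtain ⟨t, ht, hFt⟩ := frequently_atTop.1 hfreq
    (max (T₀ + N * (a + b)) (K + 2 * (a + b)))
  have ht1 := (le_max_left _ _).trans ht
  have ht2 := (le_max_right _ _).trans ht
  have hwin : ∀ u, t - K - (a + b) ≤ u → u < t - K → s - ε / 2 ≤ F u := by
    intro u hu1 hu2
    obtain ⟨i, hi, j, hj, hF⟩ := hKN t u (by linarith) hu1 hu2.le
    have hi' : (i : ℝ) * a ≤ N * a := by gcongr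
    have hj' : (j : ℝ) * b ≤ N * b := by gcongr
    have := hh.sub_pow_mul_le hr (min_le_left p q) (min_le_right p q) hδ.le
      (fun v hv => (hT v (by linarith [le_max_left T 0])).le) hFt.le i j (by linarith)
    have hpow : (2 / r) ^ (i + j) * δ ≤ ε / 4 := by
      calc (2 / r) ^ (i + j) * δ ≤ (2 / r) ^ (2 * N) * δ := by
            gcongr
            omega
        _ = ε / 4 := by rw [hδ_def]; field_simp
    linarith
  -- The window has length `a + b`, so the minimum principle extends its lower bound to all later
  -- times; the liminf is thereby close to the limsup.
  have hwin' : ∀ u, t - K - (a + b) ≤ u → s - ε / 2 ≤ F u := fun u hu =>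
    (h.mono (T' := t - K) (by linarith)).ge_of_ge hwin hu
  refine ⟨max T (t - K), fun u hu => ?_⟩
  have hu1 := (le_max_left _ _).trans_lt hu
  have hu2 := (le_max_right _ _).trans_lt hu
  rw [Real.dist_eq, abs_lt]
  constructor
  · linarith [hwin' u (by linarith)]
  · linarith [hT u hu1.le]

theorem tendsto_integral_sub {l : ℝ} (hF : Tendsto F atTop (𝓝 l))
    (hint : ∀ x y, IntervalIntegrable F volume x y) (c : ℝ) :
    Tendsto (fun t => ∫ s in (t - c)..t, F s) atTop (𝓝 (c * l)) := by
  have hc : ∀ t, (∫ s in (t - c)..t, F s) - c * l = ∫ s in (t - c)..t, (F s - l) := by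
    intro t
    rw [intervalIntegral.integral_sub (hint _ _) (by simp)]
    simp
  rw [← tendsto_sub_nhds_zero_iff]
  simp_rw [hc]
  rw [Metric.tendsto_atTop']
  intro ε hε
  have hη : 0 < ε / (|c| + 1) := by positivity
  obtain ⟨T, hT⟩ := Metric.tendsto_atTop.1 hF _ hη
  refine ⟨T + |c|, fun t ht => ?_⟩
  rw [dist_zero_right]
  have := intervalIntegral.norm_integral_le_of_norm_le_const (a := t - c) (b := t)
    (f := fun s => F s - l) (C := ε / (|c| + 1)) (fun s hs => by
      have : t - |c| ≤ s := by
        rcases Set.mem_uIoc.1 hs with h | h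
        · linarith [le_abs_self c, h.1]
        · linarith [abs_nonneg c, h.1]
      exact (hT s (by linarith)).le)
  refine this.trans_lt ?_
  rw [sub_sub_cancel, div_mul_eq_mul_div, div_lt_iff₀ (by positivity)]
  nlinarith

/-- The limit of a solution of the renewal equation is determined by its initial values. -/
theorem mul_limit_eq (h : IsHarmonicFrom p q a b 0 F) {l : ℝ} (hF : Tendsto F atTop (𝓝 l))
    (hint : ∀ x y, IntervalIntegrable F volume x y) :
    (p * a + q * b) * l = p * (∫ s in (-a)..0, F s) + q * ∫ s in (-b)..0, F s := by
  -- The conserved quantity: its formal derivative is `F t - p F (t - a) - q F (t - b) = 0`.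
  -- Integrating the renewal equation over `[0, t]` gives this without differentiability of `F`.
  have hconst : ∀ t, 0 ≤ t → p * (∫ s in (t - a)..t, F s) + q * (∫ s in (t - b)..t, F s) =
      p * (∫ s in (-a)..0, F s) + q * ∫ s in (-b)..0, F s := by
    intro t ht
    have e1 : (∫ s in (0 : ℝ)..t, F s) =
        p * (∫ s in (-a)..(t - a), F s) + q * ∫ s in (-b)..(t - b), F s := by
      have : (∫ s in (0 : ℝ)..t, F s) = ∫ s in (0 : ℝ)..t, (p * F (s - a) + q * F (s - b)) := by
        refine intervalIntegral.integral_congr fun s hs => h.eq s ?_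
        rw [Set.uIcc_of_le ht] at hs
        exact hs.1
      rw [this, intervalIntegral.integral_add, intervalIntegral.integral_const_mul,
        intervalIntegral.integral_const_mul, intervalIntegral.integral_comp_sub_right F a,
        intervalIntegral.integral_comp_sub_right F b, zero_sub, zero_sub]
      · have := (hint (0 - a) (t - a)).comp_sub_right a
        simp only [sub_add_cancel] at this
        exact this.const_mul p
      · have := (hint (0 - b) (t - b)).comp_sub_right b
        simp only [sub_add_cancel] at this
        exact this.const_mul q
    have e2 : ∀ c, (∫ s in (t - c)..t, F s) =
        (∫ s in (-c)..0, F s) + (∫ s in (0 : ℝ)..t, F s) - ∫ s in (-c)..(t - c), F s := by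
      intro c
      rw [intervalIntegral.integral_add_adjacent_intervals (hint _ _) (hint _ _),
        ← intervalIntegral.integral_add_adjacent_intervals (hint (-c) (t - c)) (hint (t - c) t)]
      ring
    rw [e2 a, e2 b]
    linear_combination (h.add_eq) * (∫ s in (0 : ℝ)..t, F s) + e1
  have h1 := ((tendsto_integral_sub hF hint a).const_mul p).add
    ((tendsto_integral_sub hF hint b).const_mul q)
  have h2 := tendsto_nhds_unique (h1.congr' ((eventually_ge_atTop 0).mono hconst))
    tendsto_const_nhds
  rw [← h2]; ring

end IsHarmonicFrom

/-! ### Natural combinations of two positive numbers. -/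

/-- If `y > 0` is an integer combination of `a` and `b`, then the natural combinations of `a` and
`b` meet all intervals of length `y` that are far enough to the right. -/
theorem exists_natCast_mul_add_mem {a b : ℝ} (ha : 0 < a) (hb : 0 < b) {m n : ℤ}
    (hy : 0 < m * a + n * b) : ∃ K : ℝ, 0 ≤ K ∧ ∀ x, K ≤ x → ∃ i j : ℕ,
      x ≤ i * a + j * b ∧ i * a + j * b < x + (m * a + n * b) := by
  set y := m * a + n * b with hydef
  -- Reserve the natural combination `J(|m|a + |n|b)`, cover the rest of `x` by `l` copies of `a`,
  -- and bridge the remainder, less than `a`, by `j ≤ J` steps of `y = ma + nb`. The reserve keeps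
  -- the coefficients `J|m| + jm` and `J|n| + jn` nonnegative.
  set J := ⌈a / y⌉₊
  refine ⟨J * (|m| * a + |n| * b), by positivity, fun x hx => ?_⟩
  set z := x - J * (|m| * a + |n| * b) with hz
  have hz0 : 0 ≤ z := by linarith
  set l := ⌊z / a⌋₊
  set j := ⌈(z - l * a) / y⌉₊
  have hl1 : l * a ≤ z := by
    have := Nat.floor_le (div_nonneg hz0 ha.le); rwa [le_div_iff₀ ha] at this
  have hl2 : z < (l + 1) * a := by
    have := Nat.lt_floor_add_one (z / a); rwa [div_lt_iff₀ ha] at this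
  have hr0 : 0 ≤ z - l * a := by linarith
  have hj1 : z - l * a ≤ j * y := by
    have := Nat.le_ceil ((z - l * a) / y); rwa [div_le_iff₀ hy] at this
  have hj2 : j * y < z - l * a + y := by
    have := Nat.ceil_lt_add_one (div_nonneg hr0 hy.le)
    rw [← sub_lt_iff_lt_add, lt_div_iff₀ hy] at this
    linarith
  have hjJ : j ≤ J := by
    apply Nat.ceil_mono
    gcongr
    linarith
  have hpos : ∀ k : ℤ, 0 ≤ (J : ℤ) * |k| + j * k := by
    intro k
    have h1 : (j : ℤ) ≤ J := by exact_mod_cast hjJ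
    have h2 : (j : ℤ) * |k| ≤ J * |k| := by gcongr
    have h3 : (j : ℤ) * (-|k|) ≤ j * k := by gcongr; exact neg_abs_le k
    linarith
  obtain ⟨i', hi'⟩ := Int.eq_ofNat_of_zero_le (hpos m)
  obtain ⟨j', hj'⟩ := Int.eq_ofNat_of_zero_le (hpos n)
  have hi'' : (i' : ℝ) = J * |(m : ℝ)| + j * m := by exact_mod_cast hi'.symm
  have hj'' : (j' : ℝ) = J * |(n : ℝ)| + j * n := by exact_mod_cast hj'.symm
  have hsum : ((l + i' : ℕ) : ℝ) * a + j' * b =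
      J * (|(m : ℝ)| * a + |(n : ℝ)| * b) + l * a + j * y := by
    push_cast
    rw [hi'', hj'', hydef]; ring
  push_cast at hz hx
  refine ⟨l + i', j', ?_, ?_⟩ <;> rw [hsum] <;> linarith

/-! ### Sums over the words of bounded cost. -/

section CostSum

variable {p : ℝ}

/-- The sum of `f` over all words of cost at most `t`. -/
def costSum (p : ℝ) (f : List Bool → ℝ) (t : ℝ) : ℝ := ∑ᶠ w ∈ {w | wordCost p w ≤ t}, f w

theorem exists_finset_wordCost_le (hp₀ : 0 < p) (hp₁ : p < 1) (t : ℝ) :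
    ∃ s : Finset (List Bool), ∀ w, w ∈ s ↔ wordCost p w ≤ t := by
  set m := min (letterCost p true) (letterCost p false)
  have hm : 0 < m := lt_min (letterCost_pos hp₀ hp₁ _) (letterCost_pos hp₀ hp₁ _)
  have hfin : {w : List Bool | wordCost p w ≤ t}.Finite := by
    refine (List.finite_length_le Bool ⌊t / m⌋₊).subset fun w hw => ?_
    have h1 := length_mul_le_wordCost (p := p) (m := m)
      (fun b => by cases b; exacts [min_le_right _ _, min_le_left _ _]) w
    refine Nat.le_floor ?_
    rw [le_div_iff₀ hm]
    exact h1.trans hw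
  exact ⟨hfin.toFinset, fun w => by simp⟩

theorem costSum_eq_sum {f : List Bool → ℝ} {t : ℝ} {s : Finset (List Bool)}
    (hs : ∀ w, w ∈ s ↔ wordCost p w ≤ t) : costSum p f t = ∑ w ∈ s, f w := by
  rw [costSum, ← finsum_mem_coe_finset]
  congr! 3 with w
  simp [hs]

/-- The hypothesis compares sets of words rather than asking `t ≤ u`: in the lattice case `t` may
exceed `u` with no word cost in between, and the comparison is needed there too. -/
theorem costSum_mono (hp₀ : 0 < p) (hp₁ : p < 1) {f : List Bool → ℝ} (hf : ∀ w, 0 ≤ f w) {t u : ℝ}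
    (h : ∀ w, wordCost p w ≤ t → wordCost p w ≤ u) : costSum p f t ≤ costSum p f u := by
  obtain ⟨s, hs⟩ := exists_finset_wordCost_le hp₀ hp₁ t
  obtain ⟨s', hs'⟩ := exists_finset_wordCost_le hp₀ hp₁ u
  rw [costSum_eq_sum hs, costSum_eq_sum hs']
  exact Finset.sum_le_sum_of_subset_of_nonneg
    (fun w hw => (hs' w).2 (h w ((hs w).1 hw))) fun w _ _ => hf w

theorem costSum_of_neg (hp₀ : 0 < p) (hp₁ : p < 1) {f : List Bool → ℝ} {t : ℝ} (ht : t < 0) :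
    costSum p f t = 0 := by
  rw [costSum_eq_sum (s := ∅) fun w => ?_, Finset.sum_empty]
  simpa using ht.trans_le (wordCost_nonneg hp₀ hp₁ w)

/-- Classify the words by their first letter; the empty word contributes because `t ≥ 0`. -/
theorem costSum_recurrence (hp₀ : 0 < p) (hp₁ : p < 1) {f : List Bool → ℝ} {g : Bool → ℝ}
    (hf : ∀ b w, f (b :: w) = g b * f w) {t : ℝ} (ht : 0 ≤ t) :
    costSum p f t = f [] + g true * costSum p f (t - letterCost p true) +
      g false * costSum p f (t - letterCost p false) := by
  obtain ⟨s₁, h₁⟩ := exists_finset_wordCost_le hp₀ hp₁ (t - letterCost p true)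
  obtain ⟨s₀, h₀⟩ := exists_finset_wordCost_le hp₀ hp₁ (t - letterCost p false)
  have hs : ∀ w, w ∈ insert [] (s₁.image (List.cons true) ∪ s₀.image (List.cons false)) ↔
      wordCost p w ≤ t := by
    intro w
    match w with
    | [] => simpa using ht
    | true :: w => simp [h₁, le_sub_iff_add_le']
    | false :: w => simp [h₀, le_sub_iff_add_le']
  rw [costSum_eq_sum hs, costSum_eq_sum h₁, costSum_eq_sum h₀, Finset.sum_insert (by simp),
    Finset.sum_union, Finset.sum_image (by simp), Finset.sum_image (by simp)]
  · simp only [hf, ← Finset.mul_sum]; ring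
  · rw [Finset.disjoint_left]
    rintro w hw hw'
    simp only [Finset.mem_image] at hw hw'
    obtain ⟨v, -, rfl⟩ := hw
    obtain ⟨v', -, h⟩ := hw'
    simp at h

/-- The number of leaves of the tree whose internal nodes are the words of cost at most `t`. -/
def leafCount (p t : ℝ) : ℝ := costSum p (fun _ => 1) t + 1

/-- The expected depth of the tree whose internal nodes are the words of cost at most `t`. -/
def meanDepth (p t : ℝ) : ℝ := costSum p (wordProb p) t

theorem leafCount_of_neg (hp₀ : 0 < p) (hp₁ : p < 1) {t : ℝ} (ht : t < 0) :
    leafCount p t = 1 := by rw [leafCount, costSum_of_neg hp₀ hp₁ ht, zero_add]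

theorem meanDepth_of_neg (hp₀ : 0 < p) (hp₁ : p < 1) {t : ℝ} (ht : t < 0) :
    meanDepth p t = 0 := costSum_of_neg hp₀ hp₁ ht

theorem leafCount_eq (hp₀ : 0 < p) (hp₁ : p < 1) {t : ℝ} (ht : 0 ≤ t) :
    leafCount p t =
      leafCount p (t - letterCost p true) + leafCount p (t - letterCost p false) := by
  have := costSum_recurrence hp₀ hp₁ (f := fun _ => 1) (g := fun _ => 1) (by simp) ht
  simp only [leafCount, this]; ring

theorem meanDepth_eq (hp₀ : 0 < p) (hp₁ : p < 1) {t : ℝ} (ht : 0 ≤ t) :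
    meanDepth p t = 1 + p * meanDepth p (t - letterCost p true) +
      (1 - p) * meanDepth p (t - letterCost p false) := by
  have := costSum_recurrence hp₀ hp₁ (f := wordProb p) (g := letterProb p) wordProb_cons ht
  rwa [wordProb_nil, letterProb_true, letterProb_false] at this

theorem leafCount_mono (hp₀ : 0 < p) (hp₁ : p < 1) {t u : ℝ}
    (h : ∀ w, wordCost p w ≤ t → wordCost p w ≤ u) : leafCount p t ≤ leafCount p u :=
  add_le_add_left (costSum_mono hp₀ hp₁ (fun _ => zero_le_one) h) 1

theorem meanDepth_mono (hp₀ : 0 < p) (hp₁ : p < 1) {t u : ℝ}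
    (h : ∀ w, wordCost p w ≤ t → wordCost p w ≤ u) : meanDepth p t ≤ meanDepth p u :=
  costSum_mono hp₀ hp₁ (fun w => (wordProb_pos hp₀ hp₁ w).le) h

theorem leafCount_pos (hp₀ : 0 < p) (hp₁ : p < 1) (t : ℝ) : 0 < leafCount p t := by
  obtain ⟨s, hs⟩ := exists_finset_wordCost_le hp₀ hp₁ t
  rw [leafCount, costSum_eq_sum hs]
  positivity

end CostSum

/-! ### Renewal asymptotics of the leaf count and the mean depth. -/

/-- A time scale that is compatible with the costs of the words: real time if the costs of the two
letters are incommensurable, and lattice time if they are commensurable. -/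
structure IsClock (p : ℝ) (τ : ℝ → ℝ) : Prop where
  mono : Monotone τ
  sub_letterCost : ∀ b t, τ (t - letterCost p b) = τ t - letterCost p b
  reach : ∀ η > 0, ∃ (K : ℝ) (N : ℕ), ∀ t u,
    t - K - (letterCost p true + letterCost p false) ≤ u → u ≤ t - K →
      ∃ i ≤ N, ∃ j ≤ N,
        (∀ w, wordCost p w ≤ t - i * letterCost p true - j * letterCost p false →
          wordCost p w ≤ u) ∧
        τ u ≤ τ (t - i * letterCost p true - j * letterCost p false) + η

namespace IsClock

variable {p : ℝ} {τ : ℝ → ℝ}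

/-- Exponential tilting: shifting the clock by a letter cost produces the factor `e^{-a} = p` or
`e^{-b} = q`, which turns the unweighted recurrence into an average. -/
theorem isHarmonicFrom_leafCount (h : IsClock p τ) (hp₀ : 0 < p) (hp₁ : p < 1) :
    IsHarmonicFrom p (1 - p) (letterCost p true) (letterCost p false) 0
      (fun t => Real.exp (-τ t) * leafCount p t) where
  p_pos := hp₀
  q_pos := sub_pos.2 hp₁
  add_eq := by ring
  a_pos := letterCost_pos hp₀ hp₁ _
  b_pos := letterCost_pos hp₀ hp₁ _
  eq t ht := by
    have h1 := exp_neg_letterCost hp₀ hp₁ true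
    have h0 := exp_neg_letterCost hp₀ hp₁ false
    rw [letterProb_true] at h1
    rw [letterProb_false] at h0
    have e : ∀ c, Real.exp (-(τ t - c)) * Real.exp (-c) = Real.exp (-τ t) := fun c => by
      rw [← Real.exp_add]; congr 1; ring
    rw [leafCount_eq hp₀ hp₁ ht, h.sub_letterCost, h.sub_letterCost]
    have e1 := e (letterCost p true)
    have e0 := e (letterCost p false)
    rw [h1] at e1
    rw [h0] at e0
    linear_combination -e1 * leafCount p (t - letterCost p true)
      - e0 * leafCount p (t - letterCost p false)

/-- The mean decrease of the clock in one step is `p a + q b = H`, so subtracting `τ / H` removes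
the constant `1` from the recurrence. -/
theorem isHarmonicFrom_meanDepth (h : IsClock p τ) (hp₀ : 0 < p) (hp₁ : p < 1) :
    IsHarmonicFrom p (1 - p) (letterCost p true) (letterCost p false) 0
      (fun t => meanDepth p t - τ t / entropy p) where
  p_pos := hp₀
  q_pos := sub_pos.2 hp₁
  add_eq := by ring
  a_pos := letterCost_pos hp₀ hp₁ _
  b_pos := letterCost_pos hp₀ hp₁ _
  eq t ht := by
    have hH := entropy_pos hp₀ hp₁
    have hH' := entropy_eq (p := p)
    rw [meanDepth_eq hp₀ hp₁ ht, h.sub_letterCost, h.sub_letterCost]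
    field_simp
    linear_combination hH'

theorem exists_bound_leafCount (h : IsClock p τ) (hp₀ : 0 < p) (hp₁ : p < 1) :
    ∃ B, 0 < B ∧
      ∀ t, -(letterCost p true + letterCost p false) ≤ t →
        Real.exp (-τ t) * leafCount p t ≤ B := by
  refine ⟨Real.exp (-τ (-(letterCost p true + letterCost p false))), Real.exp_pos _,
    fun t ht => ?_⟩
  refine (h.isHarmonicFrom_leafCount hp₀ hp₁).le_of_le (fun s h1 h2 => ?_) (by linarith)
  rw [zero_sub] at h1
  rw [leafCount_of_neg hp₀ hp₁ h2, mul_one, Real.exp_le_exp, neg_le_neg_iff]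
  exact h.mono h1

theorem exists_tendsto_leafCount (h : IsClock p τ) (hp₀ : 0 < p) (hp₁ : p < 1) :
    ∃ l, Tendsto (fun t => Real.exp (-τ t) * leafCount p t) atTop (𝓝 l) := by
  obtain ⟨B, hB0, hB⟩ := h.exists_bound_leafCount hp₀ hp₁
  have ha := letterCost_pos hp₀ hp₁ true
  have hb := letterCost_pos hp₀ hp₁ false
  refine (h.isHarmonicFrom_leafCount hp₀ hp₁).exists_tendsto (B := B) (fun t h1 _ => ?_)
    fun ε hε => ?_
  · rw [abs_of_pos (mul_pos (Real.exp_pos _) (leafCount_pos hp₀ hp₁ t))]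
    exact hB t h1
  -- A clock error `η` multiplies by `e^η = 1 + ε / B`, which changes a quantity bounded by `B` by
  -- at most `ε`.
  · set η := Real.log (1 + ε / B) with hη
    have hη0 : 0 < η := Real.log_pos (by linarith [div_pos hε hB0])
    obtain ⟨K, N, hKN⟩ := h.reach η hη0
    refine ⟨K, N, fun t u hu h1 h2 => ?_⟩
    obtain ⟨i, hi, j, hj, hv, hτ⟩ := hKN t u h1 h2
    refine ⟨i, hi, j, hj, ?_⟩
    have hBu := hB u (by linarith)
    have hpos := leafCount_pos hp₀ hp₁ u
    calc _ ≤ Real.exp (-τ u + η) * leafCount p u :=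
          mul_le_mul (Real.exp_le_exp.2 (by linarith)) (leafCount_mono hp₀ hp₁ hv)
            (leafCount_pos hp₀ hp₁ _).le (Real.exp_pos _).le
      _ = Real.exp (-τ u) * leafCount p u + ε / B * (Real.exp (-τ u) * leafCount p u) := by
          rw [Real.exp_add, hη, Real.exp_log (by positivity)]; ring
      _ ≤ Real.exp (-τ u) * leafCount p u + ε / B * B := by gcongr
      _ = Real.exp (-τ u) * leafCount p u + ε := by rw [div_mul_cancel₀ _ hB0.ne']

theorem exists_tendsto_meanDepth (h : IsClock p τ) (hp₀ : 0 < p) (hp₁ : p < 1) :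
    ∃ l, Tendsto (fun t => meanDepth p t - τ t / entropy p) atTop (𝓝 l) := by
  have hH := entropy_pos hp₀ hp₁
  refine (h.isHarmonicFrom_meanDepth hp₀ hp₁).exists_tendsto
    (B := (|τ (-(letterCost p true + letterCost p false))| + |τ 0|) / entropy p)
    (fun t h1 h2 => ?_) fun ε hε => ?_
  · rw [meanDepth_of_neg hp₀ hp₁ h2, zero_sub, abs_neg, abs_div, abs_of_pos hH]
    gcongr
    have e1 := h.mono h1
    have e2 := h.mono h2.le
    rw [abs_le]
    constructor
    · linarith [neg_abs_le (τ (-(letterCost p true + letterCost p false))), abs_nonneg (τ 0)]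
    · linarith [le_abs_self (τ 0), abs_nonneg (τ (-(letterCost p true + letterCost p false)))]
  · obtain ⟨K, N, hKN⟩ := h.reach (ε * entropy p) (by positivity)
    refine ⟨K, N, fun t u hu h1 h2 => ?_⟩
    obtain ⟨i, hi, j, hj, hv, hτ⟩ := hKN t u h1 h2
    refine ⟨i, hi, j, hj, ?_⟩
    have := meanDepth_mono hp₀ hp₁ hv
    have e := div_le_div_of_nonneg_right hτ hH.le
    rw [add_div, mul_div_cancel_right₀ _ hH.ne'] at e
    linarith

theorem intervalIntegrable_exp_neg (h : IsClock p τ) (x y : ℝ) :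
    IntervalIntegrable (fun t => Real.exp (-τ t)) volume x y :=
  Antitone.intervalIntegrable fun _ _ hst => Real.exp_le_exp.2 (neg_le_neg (h.mono hst))

/-- The limit of `e^{-τ t}` times the number of leaves. -/
theorem tendsto_leafCount (h : IsClock p τ) (hp₀ : 0 < p) (hp₁ : p < 1) :
    Tendsto (fun t => Real.exp (-τ t) * leafCount p t) atTop
      (𝓝 ((p * (∫ s in (-letterCost p true)..0, Real.exp (-τ s)) +
        (1 - p) * ∫ s in (-letterCost p false)..0, Real.exp (-τ s)) / entropy p)) := by
  obtain ⟨l, hl⟩ := h.exists_tendsto_leafCount hp₀ hp₁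
  have hmono : Monotone (leafCount p) := fun t u htu =>
    leafCount_mono hp₀ hp₁ fun w hw => hw.trans htu
  have hint : ∀ x y, IntervalIntegrable (fun t => Real.exp (-τ t) * leafCount p t) volume x y := by
    intro x y
    rw [intervalIntegrable_iff]
    refine Integrable.bdd_mul (c := Real.exp (-τ (min x y)))
      (intervalIntegrable_iff.1 (hmono.intervalIntegrable (a := x) (b := y)))
      (intervalIntegrable_iff.1 (h.intervalIntegrable_exp_neg x y)).1 ?_
    refine (ae_restrict_mem measurableSet_uIoc).mono fun s hs => ?_
    rw [Real.norm_eq_abs, Real.abs_exp, Real.exp_le_exp, neg_le_neg_iff]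
    exact h.mono hs.1.le
  have key := (h.isHarmonicFrom_leafCount hp₀ hp₁).mul_limit_eq hl hint
  -- At negative thresholds the tree is a single leaf, so only the clock enters the limit.
  have hneg : ∀ c, 0 < c → ∫ s in (-c)..0, Real.exp (-τ s) * leafCount p s =
      ∫ s in (-c)..0, Real.exp (-τ s) := fun c hc =>
    intervalIntegral.integral_congr_Ioo_of_le (by linarith) fun s hs => by
      simp only [leafCount_of_neg hp₀ hp₁ hs.2, mul_one]
  rw [hneg _ (letterCost_pos hp₀ hp₁ _), hneg _ (letterCost_pos hp₀ hp₁ _), ← entropy_eq] at key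
  rwa [← key, mul_div_cancel_left₀ _ (entropy_pos hp₀ hp₁).ne']

/-- The limit of the difference of the expected depth and `τ t / H`. -/
theorem tendsto_meanDepth (h : IsClock p τ) (hp₀ : 0 < p) (hp₁ : p < 1) :
    Tendsto (fun t => meanDepth p t - τ t / entropy p) atTop
      (𝓝 (-(p * (∫ s in (-letterCost p true)..0, τ s) +
        (1 - p) * ∫ s in (-letterCost p false)..0, τ s) / entropy p ^ 2)) := by
  obtain ⟨l, hl⟩ := h.exists_tendsto_meanDepth hp₀ hp₁
  have hmono : Monotone (meanDepth p) := fun t u htu =>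
    meanDepth_mono hp₀ hp₁ fun w hw => hw.trans htu
  have key := (h.isHarmonicFrom_meanDepth hp₀ hp₁).mul_limit_eq hl fun x y =>
    hmono.intervalIntegrable.sub (h.mono.intervalIntegrable.div_const _)
  have hneg : ∀ c, 0 < c → ∫ s in (-c)..0, (meanDepth p s - τ s / entropy p) =
      -(∫ s in (-c)..0, τ s) / entropy p := fun c hc => by
    rw [← intervalIntegral.integral_neg, ← intervalIntegral.integral_div]
    refine intervalIntegral.integral_congr_Ioo_of_le (by linarith) fun s hs => ?_
    simp only [meanDepth_of_neg hp₀ hp₁ hs.2]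
    ring
  have hH := (entropy_pos hp₀ hp₁).ne'
  rw [hneg _ (letterCost_pos hp₀ hp₁ _), hneg _ (letterCost_pos hp₀ hp₁ _), ← entropy_eq] at key
  have : l = -(p * (∫ s in (-letterCost p true)..0, τ s) +
        (1 - p) * ∫ s in (-letterCost p false)..0, τ s) / entropy p ^ 2 := by
    field_simp at key ⊢
    linear_combination key
  rwa [← this]

end IsClock

/-- On a bounded range of targets the coefficients are bounded, as required for the uniform `N` in
`IsClock.reach`. -/
theorem exists_bounded_natCast_mul_add_mem {a b : ℝ} (ha : 0 < a) (hb : 0 < b) {m n : ℤ}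
    (hy : 0 < m * a + n * b) (R : ℝ) : ∃ (K : ℝ) (N : ℕ), ∀ x, K ≤ x → x ≤ K + R →
      ∃ i ≤ N, ∃ j ≤ N, x ≤ i * a + j * b ∧ i * a + j * b < x + (m * a + n * b) := by
  obtain ⟨K, -, hK⟩ := exists_natCast_mul_add_mem ha hb hy
  set Z := K + R + (m * a + n * b) with hZ
  refine ⟨K, ⌊Z / a⌋₊ + ⌊Z / b⌋₊, fun x h1 h2 => ?_⟩
  obtain ⟨i, j, hx1, hx2⟩ := hK x h1
  have hia : 0 ≤ i * a := by positivity
  have hjb : 0 ≤ j * b := by positivity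
  refine ⟨i, ?_, j, ?_, hx1, hx2⟩
  · refine (Nat.le_floor ?_).trans (Nat.le_add_right _ _)
    rw [le_div_iff₀ ha]; linarith
  · refine (Nat.le_floor ?_).trans (Nat.le_add_left _ _)
    rw [le_div_iff₀ hb]; linarith

/-! ### The two clocks: real time and lattice time. -/

section Clocks

variable {p : ℝ}

theorem isClock_id (hp₀ : 0 < p) (hp₁ : p < 1)
    (h : Irrational (Real.log p / Real.log (1 - p))) : IsClock p (fun t => t) where
  mono := monotone_id
  sub_letterCost _ _ := rfl
  reach η hη := by
    have hirr : Irrational (letterCost p true / letterCost p false) := by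
      rwa [letterCost_true, letterCost_false, neg_div_neg_eq]
    -- Irrationality makes the group generated by the two costs dense, so it contains an arbitrarily
    -- small positive step.
    obtain ⟨y, hy, hy0, hyη⟩ := (dense_addSubgroupClosure_pair_iff.2 hirr).exists_between hη
    obtain ⟨m, n, rfl⟩ := AddSubgroup.mem_closure_pair.1 hy
    simp only [zsmul_eq_mul] at hy0 hyη
    obtain ⟨K, N, hKN⟩ := exists_bounded_natCast_mul_add_mem (letterCost_pos hp₀ hp₁ true)
      (letterCost_pos hp₀ hp₁ false) hy0 (letterCost p true + letterCost p false)
    refine ⟨K, N, fun t u h1 h2 => ?_⟩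
    obtain ⟨i, hi, j, hj, hx1, hx2⟩ := hKN (t - u) (by linarith) (by linarith)
    exact ⟨i, hi, j, hj, fun w hw => by linarith, by linarith⟩

/-- Lattice time. -/
def latticeFloor (d t : ℝ) : ℝ := d * ⌊t / d⌋

theorem latticeFloor_le {d : ℝ} (hd : 0 < d) (t : ℝ) : latticeFloor d t ≤ t := by
  have := Int.floor_le (t / d)
  rw [le_div_iff₀ hd] at this
  rw [latticeFloor]; linarith

theorem lt_latticeFloor_add {d : ℝ} (hd : 0 < d) (t : ℝ) : t < latticeFloor d t + d := by
  have := Int.lt_floor_add_one (t / d)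
  rw [div_lt_iff₀ hd] at this
  rw [latticeFloor]; linarith

theorem latticeFloor_sub_intCast_mul {d : ℝ} (hd : 0 < d) (t : ℝ) (k : ℤ) :
    latticeFloor d (t - k * d) = latticeFloor d t - k * d := by
  rw [latticeFloor, sub_div, mul_div_cancel_right₀ _ hd.ne', Int.floor_sub_intCast, latticeFloor]
  push_cast; ring

theorem latticeFloor_intCast_mul {d : ℝ} (hd : 0 < d) (k : ℤ) :
    latticeFloor d (k * d) = k * d := by
  rw [latticeFloor, mul_div_cancel_right₀ _ hd.ne', Int.floor_intCast, mul_comm]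

theorem intCast_mul_le_latticeFloor {d : ℝ} (hd : 0 < d) {k : ℤ} {t : ℝ} (h : k * d ≤ t) :
    k * d ≤ latticeFloor d t := by
  rw [latticeFloor, mul_comm d]
  have : k ≤ ⌊t / d⌋ := Int.le_floor.2 (by rwa [le_div_iff₀ hd])
  gcongr

/-- If `ln p / ln q` is rational, then the costs of the letters are coprime multiples of `d`. -/
theorem exists_coprime_letterCost (hp₀ : 0 < p) (hp₁ : p < 1)
    (h : ¬ Irrational (Real.log p / Real.log (1 - p))) :
    0 < Tunstall.span p ∧ ∃ k l : ℕ, letterCost p true = k * Tunstall.span p ∧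
      letterCost p false = l * Tunstall.span p ∧ IsCoprime (k : ℤ) l := by
  obtain ⟨⟨hd, ⟨k, hk⟩, ⟨l, hl⟩⟩, hmax⟩ := isGreatest_span hp₀ hp₁ h
  set d := Tunstall.span p
  have ha := letterCost_pos hp₀ hp₁ true
  have hb := letterCost_pos hp₀ hp₁ false
  rw [letterCost_true] at ha ⊢
  rw [letterCost_false] at hb ⊢
  have hk0 : k < 0 := by
    have : (k : ℝ) < 0 := by by_contra hc; push Not at hc; nlinarith
    exact_mod_cast this
  have hl0 : l < 0 := by
    have : (l : ℝ) < 0 := by by_contra hc; push Not at hc; nlinarith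
    exact_mod_cast this
  obtain ⟨k', hk'⟩ := Int.eq_ofNat_of_zero_le (show 0 ≤ -k by omega)
  obtain ⟨l', hl'⟩ := Int.eq_ofNat_of_zero_le (show 0 ≤ -l by omega)
  have hkr : (k' : ℝ) = -k := by exact_mod_cast hk'.symm
  have hlr : (l' : ℝ) = -l := by exact_mod_cast hl'.symm
  refine ⟨hd, k', l', by rw [hk, hkr]; ring, by rw [hl, hlr]; ring, ?_⟩
  have hcop : IsCoprime k l := by
    rw [Int.isCoprime_iff_gcd_eq_one]
    have hg : 0 < Int.gcd k l := Int.gcd_pos_of_ne_zero_left _ hk0.ne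
    obtain ⟨k₁, hk₁⟩ := Int.gcd_dvd_left (a := k) (b := l)
    obtain ⟨l₁, hl₁⟩ := Int.gcd_dvd_right (a := k) (b := l)
    -- Multiplying `d` by the gcd of the coefficients gives another common divisor of the
    -- logarithms, so maximality of `d` makes that gcd `1`.
    have hle : (Int.gcd k l : ℝ) * d ≤ d := hmax ⟨by positivity,
      ⟨k₁, by rw [hk]; nth_rewrite 1 [hk₁]; push_cast; ring⟩,
      ⟨l₁, by rw [hl]; nth_rewrite 1 [hl₁]; push_cast; ring⟩⟩
    have : (Int.gcd k l : ℝ) ≤ 1 := le_of_mul_le_mul_right (by linarith) hd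
    have : Int.gcd k l ≤ 1 := by exact_mod_cast this
    omega
  have := hcop.neg_neg
  rwa [hk', hl'] at this

theorem exists_wordCost_eq_mul {d : ℝ} {k l : ℕ} (hk : letterCost p true = k * d)
    (hl : letterCost p false = l * d) (w : List Bool) : ∃ n : ℕ, wordCost p w = n * d := by
  induction w with
  | nil => exact ⟨0, by simp⟩
  | cons b w ih =>
    obtain ⟨n, hn⟩ := ih
    cases b
    · exact ⟨l + n, by rw [wordCost_cons, hn, hl]; push_cast; ring⟩
    · exact ⟨k + n, by rw [wordCost_cons, hn, hk]; push_cast; ring⟩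

/-- By Bézout the step `d` itself is an integer combination of the costs, so lattice times can be
reached exactly. Word costs are lattice points, so equal lattice times mean the same words. -/
theorem isClock_latticeFloor (hp₀ : 0 < p) (hp₁ : p < 1) {d : ℝ} (hd : 0 < d) {k l : ℕ}
    (hk : letterCost p true = k * d) (hl : letterCost p false = l * d)
    (hkl : IsCoprime (k : ℤ) l) : IsClock p (latticeFloor d) where
  mono s t hst := by
    unfold latticeFloor
    gcongr
  sub_letterCost b t := by
    cases b
    · rw [hl]; exact_mod_cast latticeFloor_sub_intCast_mul hd t l
    · rw [hk]; exact_mod_cast latticeFloor_sub_intCast_mul hd t k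
  reach η hη := by
    obtain ⟨m, n, hmn⟩ := hkl
    have hmn' : (m : ℝ) * k + n * l = 1 := by exact_mod_cast hmn
    have hy : m * letterCost p true + n * letterCost p false = d := by
      rw [hk, hl]; linear_combination d * hmn'
    have hy0 : 0 < m * letterCost p true + n * letterCost p false := by rwa [hy]
    obtain ⟨K, N, hKN⟩ := exists_bounded_natCast_mul_add_mem (letterCost_pos hp₀ hp₁ true)
      (letterCost_pos hp₀ hp₁ false) hy0 (letterCost p true + letterCost p false + 2 * d)
    rw [hy] at hKN
    -- Rounding both times changes `t - u` by less than `d` in either direction; the shift of `K` by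
    -- `d` and the extra `2 * d` in the range absorb this.
    refine ⟨K + d, N, fun t u h1 h2 => ?_⟩
    have ht1 := latticeFloor_le hd t
    have ht2 := lt_latticeFloor_add hd t
    have hu1 := latticeFloor_le hd u
    have hu2 := lt_latticeFloor_add hd u
    obtain ⟨i, hi, j, hj, hx1, hx2⟩ := hKN (latticeFloor d t - latticeFloor d u) (by linarith)
      (by linarith)
    -- Both sides are multiples of `d`, and a half-open interval of length `d` starting at a
    -- multiple contains no other one.
    have hij : i * letterCost p true + j * letterCost p false =
        latticeFloor d t - latticeFloor d u := by
      have e1 : i * letterCost p true + j * letterCost p false =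
          ((i * k + j * l : ℤ) : ℝ) * d := by rw [hk, hl]; push_cast; ring
      have e2 : latticeFloor d t - latticeFloor d u = ((⌊t / d⌋ - ⌊u / d⌋ : ℤ) : ℝ) * d := by
        simp only [latticeFloor]; push_cast; ring
      rw [e1, e2] at hx1 hx2 ⊢
      have h3 := le_of_mul_le_mul_right hx1 hd
      have h4 : ((i * k + j * l : ℤ) : ℝ) < ((⌊t / d⌋ - ⌊u / d⌋ + 1 : ℤ) : ℝ) := by
        refine lt_of_mul_lt_mul_right ?_ hd.le
        push_cast at hx2 ⊢
        linarith
      have h3' := Int.cast_le.1 h3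
      have h4' := Int.cast_lt.1 h4
      congr 2
      omega
    have hfl : latticeFloor d (t - i * letterCost p true - j * letterCost p false) =
        latticeFloor d u := by
      have e : t - i * letterCost p true - j * letterCost p false =
          t - ((⌊t / d⌋ - ⌊u / d⌋ : ℤ) : ℝ) * d := by
        rw [sub_sub, hij]; simp only [latticeFloor]; push_cast; ring
      rw [e, latticeFloor_sub_intCast_mul hd]
      simp only [latticeFloor]; push_cast; ring
    refine ⟨i, hi, j, hj, fun w hw => ?_, by rw [hfl]; linarith⟩
    obtain ⟨r, hr⟩ := exists_wordCost_eq_mul hk hl w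
    have hr' : wordCost p w = (r : ℤ) * d := by exact_mod_cast hr
    rw [hr'] at hw ⊢
    have := intCast_mul_le_latticeFloor hd hw
    rw [hfl] at this
    linarith

end Clocks

/-! ### Explicit values of the limits. -/

section Limits

variable {p : ℝ}

theorem mul_exp_letterCost (hp₀ : 0 < p) (hp₁ : p < 1) :
    p * Real.exp (letterCost p true) = 1 ∧ (1 - p) * Real.exp (letterCost p false) = 1 := by
  have h1 := exp_neg_letterCost hp₀ hp₁ true
  have h0 := exp_neg_letterCost hp₀ hp₁ false
  rw [letterProb_true] at h1
  rw [letterProb_false] at h0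
  constructor
  · nth_rewrite 1 [← h1]; rw [← Real.exp_add]; simp
  · rw [← h0, ← Real.exp_add]; simp

theorem tendsto_leafCount_of_irrational (hp₀ : 0 < p) (hp₁ : p < 1)
    (h : Irrational (Real.log p / Real.log (1 - p))) :
    Tendsto (fun t => Real.exp (-t) * leafCount p t) atTop (𝓝 (1 / entropy p)) := by
  have hint : ∀ c, ∫ s in (-c)..0, Real.exp (-s) = Real.exp c - 1 := fun c => by
    rw [intervalIntegral.integral_comp_neg (fun x => Real.exp x)]; simp
  have := (isClock_id hp₀ hp₁ h).tendsto_leafCount hp₀ hp₁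
  obtain ⟨h1, h0⟩ := mul_exp_letterCost hp₀ hp₁
  rw [hint, hint] at this
  convert this using 3
  linear_combination -h1 - h0

theorem tendsto_meanDepth_of_irrational (hp₀ : 0 < p) (hp₁ : p < 1)
    (h : Irrational (Real.log p / Real.log (1 - p))) :
    Tendsto (fun t => meanDepth p t - t / entropy p) atTop
      (𝓝 (entropy₂ p / (2 * entropy p ^ 2))) := by
  have := (isClock_id hp₀ hp₁ h).tendsto_meanDepth hp₀ hp₁
  have hH := (entropy_pos hp₀ hp₁).ne'
  rw [integral_id, integral_id] at this
  convert this using 2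
  rw [entropy₂_eq]
  field_simp
  ring

/-- The integrand is constant on each lattice cell, so the integral is a finite sum, and `Φ` is its
closed form. -/
theorem integral_comp_latticeFloor {d : ℝ} (hd : 0 < d) {f : ℝ → ℝ} {Φ : ℕ → ℝ} (hΦ₀ : Φ 0 = 0)
    (hΦ : ∀ k : ℕ, Φ (k + 1) = d * f (-((k + 1) * d)) + Φ k)
    (hint : ∀ x y, IntervalIntegrable (fun s => f (latticeFloor d s)) volume x y) (k : ℕ) :
    ∫ s in (-(k * d))..0, f (latticeFloor d s) = Φ k := by
  induction k with
  | zero => simp [hΦ₀]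
  | succ k ih =>
    rw [← intervalIntegral.integral_add_adjacent_intervals (hint _ (-(k * d))) (hint _ _), ih, hΦ]
    congr 1
    have : ∫ s in (-((k + 1 : ℕ) * d))..(-(k * d)), f (latticeFloor d s) =
        ∫ s in (-((k + 1 : ℕ) * d))..(-(k * d)), f (-((k + 1) * d)) := by
      refine intervalIntegral.integral_congr_Ioo_of_le (by push_cast; linarith) fun s hs => ?_
      have hfl : ⌊s / d⌋ = -(k + 1 : ℤ) := by
        rw [Int.floor_eq_iff, le_div_iff₀ hd, div_lt_iff₀ hd]
        have h1 := hs.1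
        have h2 := hs.2
        push_cast at h1 ⊢
        constructor <;> linarith
      simp only [latticeFloor, hfl]
      congr 1; push_cast; ring
    rw [this, intervalIntegral.integral_const, smul_eq_mul]
    push_cast; ring

theorem tendsto_leafCount_of_lattice (hp₀ : 0 < p) (hp₁ : p < 1) {d : ℝ} (hd : 0 < d) {k l : ℕ}
    (hk : letterCost p true = k * d) (hl : letterCost p false = l * d)
    (hkl : IsCoprime (k : ℤ) l) :
    Tendsto (fun t => Real.exp (-latticeFloor d t) * leafCount p t) atTop
      (𝓝 (d / (1 - Real.exp (-d)) / entropy p)) := by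
  have hτ := isClock_latticeFloor hp₀ hp₁ hd hk hl hkl
  have hd1 : 1 - Real.exp (-d) ≠ 0 := by
    have := Real.exp_lt_one_iff.2 (neg_lt_zero.2 hd)
    linarith
  have hint := integral_comp_latticeFloor hd (f := fun s => Real.exp (-s))
    -- The geometric sum of `d * e^{jd}` over `1 ≤ j ≤ k`.
    (Φ := fun k => d * (Real.exp (k * d) - 1) / (1 - Real.exp (-d))) (by simp) (fun k => by
      have e : Real.exp (k * d) = Real.exp ((k + 1) * d) * Real.exp (-d) := by
        rw [← Real.exp_add]; congr 1; ring
      push_cast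
      rw [neg_neg, e]
      field_simp
      ring) hτ.intervalIntegrable_exp_neg
  have := hτ.tendsto_leafCount hp₀ hp₁
  obtain ⟨h1, h0⟩ := mul_exp_letterCost hp₀ hp₁
  rw [hk] at this h1
  rw [hl] at this h0
  rw [hint, hint] at this
  convert this using 3
  generalize Real.exp (k * d) = x at *
  generalize Real.exp (l * d) = y at *
  field_simp
  linear_combination -h1 - h0

theorem tendsto_meanDepth_of_lattice (hp₀ : 0 < p) (hp₁ : p < 1) {d : ℝ} (hd : 0 < d) {k l : ℕ}
    (hk : letterCost p true = k * d) (hl : letterCost p false = l * d)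
    (hkl : IsCoprime (k : ℤ) l) :
    Tendsto (fun t => meanDepth p t - latticeFloor d t / entropy p) atTop
      (𝓝 (entropy₂ p / (2 * entropy p ^ 2) + d / (2 * entropy p))) := by
  have hτ := isClock_latticeFloor hp₀ hp₁ hd hk hl hkl
  have hint := integral_comp_latticeFloor hd (f := fun s => s)
    (Φ := fun k => -(d ^ 2 * k * (k + 1) / 2)) (by simp) (fun k => by push_cast; ring)
    (fun x y => hτ.mono.intervalIntegrable)
  have := hτ.tendsto_meanDepth hp₀ hp₁
  have hH := (entropy_pos hp₀ hp₁).ne'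
  have hH' := entropy_eq (p := p)
  have hH₂ := entropy₂_eq (p := p)
  rw [hk, hl] at this hH' hH₂
  rw [hint, hint] at this
  convert this using 2
  field_simp
  rw [hH', hH₂]
  ring

end Limits

/-! ### Comparison of Tunstall codes with threshold trees. -/

/-- The expected length of the phrase of a random string. -/
def codeMean (p : ℝ) (D : Finset (List Bool)) : ℝ := ∑ w ∈ D, wordProb p w * w.length

theorem GrowsTree.sum_wordProb {p : ℝ} {I D : Finset (List Bool)} (h : GrowsTree I D) :
    ∑ w ∈ D, wordProb p w = 1 := by
  rw [h.sum_leaves (g := fun _ => 0) fun w => by simp [letterProb]; ring]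
  simp

theorem GrowsTree.codeMean_eq {p : ℝ} {I D : Finset (List Bool)} (h : GrowsTree I D) :
    codeMean p D = ∑ w ∈ I, wordProb p w := by
  rw [codeMean, h.sum_leaves (g := wordProb p) fun w => by simp [letterProb]; ring]
  simp

namespace IsKhodak

variable {p t : ℝ} {M : ℕ} {D I : Finset (List Bool)}

theorem card_internal (h : IsKhodak p M D I t) : (I.card : ℝ) + 1 = M := by
  rw [← h.card_leaves, h.grows.card_leaves]; push_cast; ring

/-- The `M` leaf probabilities sum to `1`, and each is at most `e^{-t}`. -/
theorem exp_le (h : IsKhodak p M D I t) (hp₀ : 0 < p) (hp₁ : p < 1) : Real.exp t ≤ M := by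
  have h1 : ∑ w ∈ D, wordProb p w ≤ ∑ w ∈ D, Real.exp (-t) := Finset.sum_le_sum fun w hw => by
    rw [wordProb_eq_exp hp₀ hp₁, Real.exp_le_exp]
    linarith [h.le_wordCost w hw]
  rw [h.grows.sum_wordProb, Finset.sum_const, h.card_leaves, nsmul_eq_mul, Real.exp_neg,
    ← div_eq_mul_inv, le_div_iff₀ (Real.exp_pos t)] at h1
  linarith

theorem le_exp (h : IsKhodak p M D I t) (hp₀ : 0 < p) (hp₁ : p < 1) :
    M ≤ Real.exp (t + (letterCost p true + letterCost p false)) := by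
  have h1 : ∑ w ∈ D, Real.exp (-(t + (letterCost p true + letterCost p false))) ≤
      ∑ w ∈ D, wordProb p w := Finset.sum_le_sum fun w hw => by
    rw [wordProb_eq_exp hp₀ hp₁, Real.exp_le_exp]
    linarith [h.wordCost_leaf_le w hw]
  rw [h.grows.sum_wordProb, Finset.sum_const, h.card_leaves, nsmul_eq_mul, Real.exp_neg,
    ← div_eq_mul_inv, div_le_iff₀ (Real.exp_pos _)] at h1
  linarith

theorem card_pos (h : IsKhodak p M D I t) : (0 : ℝ) < M := by
  rw [← h.card_internal]; positivity

theorem le_log (h : IsKhodak p M D I t) (hp₀ : 0 < p) (hp₁ : p < 1) : t ≤ Real.log M := by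
  rw [Real.le_log_iff_exp_le h.card_pos]; exact h.exp_le hp₀ hp₁

theorem log_le (h : IsKhodak p M D I t) (hp₀ : 0 < p) (hp₁ : p < 1) :
    Real.log M ≤ t + (letterCost p true + letterCost p false) := by
  rw [Real.log_le_iff_le_exp h.card_pos]; exact h.le_exp hp₀ hp₁

/-- The cost of a leaf is almost constant. -/
theorem abs_wordCost_sub_log_le (h : IsKhodak p M D I t) (hp₀ : 0 < p) (hp₁ : p < 1)
    {w : List Bool} (hw : w ∈ D) :
    |wordCost p w - Real.log M| ≤ letterCost p true + letterCost p false := by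
  have h1 := h.le_log hp₀ hp₁
  have h2 := h.log_le hp₀ hp₁
  have h3 := h.le_wordCost w hw
  have h4 := h.wordCost_leaf_le w hw
  rw [abs_le]
  constructor <;> linarith

theorem le_leafCount_and_codeMean_le (h : IsKhodak p M D I t) (hp₀ : 0 < p) (hp₁ : p < 1) :
    M ≤ leafCount p t ∧ codeMean p D ≤ meanDepth p t := by
  obtain ⟨s, hs⟩ := exists_finset_wordCost_le hp₀ hp₁ t
  have hsub : I ⊆ s := fun w hw => (hs w).2 (h.wordCost_le w hw)
  rw [leafCount, meanDepth, costSum_eq_sum hs, costSum_eq_sum hs, ← h.card_internal,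
    h.grows.codeMean_eq]
  constructor
  · rw [← Finset.cast_card]
    have := Finset.card_le_card hsub
    gcongr
  · exact Finset.sum_le_sum_of_subset_of_nonneg hsub fun w _ _ => (wordProb_pos hp₀ hp₁ w).le

/-- Only words of cost strictly below `t` are certain to be internal, hence the strict inequality
for `u`. -/
theorem leafCount_le_and_le_codeMean (h : IsKhodak p M D I t) (hp₀ : 0 < p) (hp₁ : p < 1) {u : ℝ}
    (hu : u < t) : leafCount p u ≤ M ∧ meanDepth p u ≤ codeMean p D := by
  obtain ⟨s, hs⟩ := exists_finset_wordCost_le hp₀ hp₁ u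
  have hsub : s ⊆ I := fun w hw => h.mem_internal w (((hs w).1 hw).trans_lt hu)
  rw [leafCount, meanDepth, costSum_eq_sum hs, costSum_eq_sum hs, ← h.card_internal,
    h.grows.codeMean_eq]
  constructor
  · rw [← Finset.cast_card]
    have := Finset.card_le_card hsub
    gcongr
  · exact Finset.sum_le_sum_of_subset_of_nonneg hsub fun w _ _ => (wordProb_pos hp₀ hp₁ w).le

/-- If no word has cost between `u` and `t`, then all internal nodes of cost more than `u` have
the same probability. -/
theorem codeMean_eq (h : IsKhodak p M D I t) (hp₀ : 0 < p) (hp₁ : p < 1) {u : ℝ} (hu : u < t)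
    (hgap : ∀ w, wordCost p w < t → wordCost p w ≤ u) :
    codeMean p D = meanDepth p u + (M - leafCount p u) * Real.exp (-t) := by
  obtain ⟨s, hs⟩ := exists_finset_wordCost_le hp₀ hp₁ u
  have hsub : s ⊆ I := fun w hw => h.mem_internal w (((hs w).1 hw).trans_lt hu)
  have hJ : ∑ w ∈ I \ s, wordProb p w = ∑ w ∈ I \ s, Real.exp (-t) :=
    Finset.sum_congr rfl fun w hw => by
      rw [Finset.mem_sdiff, hs] at hw
      rw [wordProb_eq_exp hp₀ hp₁, (h.wordCost_le w hw.1).antisymm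
        (not_lt.1 fun hlt => hw.2 (hgap w hlt))]
  have hcard := Finset.cast_card_sdiff (R := ℝ) hsub
  rw [h.grows.codeMean_eq, ← Finset.sum_sdiff hsub, hJ, Finset.sum_const, nsmul_eq_mul, hcard,
    leafCount, meanDepth, costSum_eq_sum hs, costSum_eq_sum hs, ← h.card_internal,
    ← Finset.cast_card]
  ring

end IsKhodak

/-! ### Asymptotics of the mean. -/

section Mean

variable {p : ℝ} {𝒟 I : ℕ → Finset (List Bool)} {t : ℕ → ℝ}

theorem tendsto_log_natCast : Tendsto (fun M : ℕ => Real.log M) atTop atTop :=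
  Real.tendsto_log_atTop.comp tendsto_natCast_atTop_atTop

theorem tendsto_threshold (hp₀ : 0 < p) (hp₁ : p < 1)
    (h : ∀ M, 1 ≤ M → IsKhodak p M (𝒟 M) (I M) (t M)) : Tendsto t atTop atTop := by
  have := tendsto_log_natCast.atTop_add
    (tendsto_const_nhds (x := -(letterCost p true + letterCost p false)))
  refine tendsto_atTop_mono' _ ?_ this
  filter_upwards [eventually_ge_atTop 1] with M hM
  linarith [(h M hM).log_le hp₀ hp₁]

theorem tendsto_codeMean_of_irrational (hp₀ : 0 < p) (hp₁ : p < 1)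
    (h : ∀ M, 1 ≤ M → IsKhodak p M (𝒟 M) (I M) (t M))
    (hirr : Irrational (Real.log p / Real.log (1 - p))) :
    Tendsto (fun M : ℕ => codeMean p (𝒟 M) - (Real.log M / entropy p +
      Real.log (entropy p) / entropy p + entropy₂ p / (2 * entropy p ^ 2))) atTop (𝓝 0) := by
  have hH := entropy_pos hp₀ hp₁
  have hleaf := tendsto_leafCount_of_irrational hp₀ hp₁ hirr
  have hmean := tendsto_meanDepth_of_irrational hp₀ hp₁ hirr
  have ht := tendsto_threshold hp₀ hp₁ h
  -- The lower comparison tree needs a threshold strictly below `t M`; any positive gap tending to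
  -- `0` would do.
  have hη : Tendsto (fun M : ℕ => 1 / (M : ℝ)) atTop (𝓝 0) := tendsto_one_div_atTop_nhds_zero_nat
  have ht' : Tendsto (fun M : ℕ => t M - 1 / (M : ℝ)) atTop atTop := by
    simpa only [sub_eq_add_neg] using ht.atTop_add hη.neg
  have hlt : ∀ M : ℕ, 1 ≤ M → t M - 1 / (M : ℝ) < t M := fun M hM =>
    sub_lt_self _ (one_div_pos.2 (by exact_mod_cast hM))
  have h1 : Tendsto (fun M : ℕ => M * Real.exp (-t M)) atTop (𝓝 (1 / entropy p)) := by
    have hlow : Tendsto (fun M : ℕ => Real.exp (-(1 / (M : ℝ))) *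
        (Real.exp (-(t M - 1 / (M : ℝ))) * leafCount p (t M - 1 / (M : ℝ)))) atTop
        (𝓝 (1 / entropy p)) := by
      have e := (Real.continuous_exp.tendsto _).comp hη.neg
      simpa using e.mul (hleaf.comp ht')
    refine tendsto_of_tendsto_of_tendsto_of_le_of_le' hlow (hleaf.comp ht) ?_ ?_
    · filter_upwards [eventually_ge_atTop 1] with M hM
      have := ((h M hM).leafCount_le_and_le_codeMean hp₀ hp₁ (hlt M hM)).1
      rw [← mul_assoc, ← Real.exp_add, mul_comm]
      gcongr
      apply le_of_eq; ring
    · filter_upwards [eventually_ge_atTop 1] with M hM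
      have := ((h M hM).le_leafCount_and_codeMean_le hp₀ hp₁).1
      simp only [Function.comp_apply]
      rw [mul_comm]
      gcongr
  have h2 : Tendsto (fun M : ℕ => codeMean p (𝒟 M) - t M / entropy p) atTop
      (𝓝 (entropy₂ p / (2 * entropy p ^ 2))) := by
    have hlow : Tendsto (fun M : ℕ => (meanDepth p (t M - 1 / (M : ℝ)) -
        (t M - 1 / (M : ℝ)) / entropy p) - 1 / (M : ℝ) / entropy p) atTop
        (𝓝 (entropy₂ p / (2 * entropy p ^ 2))) := by
      simpa using (hmean.comp ht').sub (hη.div_const (entropy p))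
    refine tendsto_of_tendsto_of_tendsto_of_le_of_le' hlow (hmean.comp ht) ?_ ?_
    · filter_upwards [eventually_ge_atTop 1] with M hM
      have := ((h M hM).leafCount_le_and_le_codeMean hp₀ hp₁ (hlt M hM)).2
      rw [sub_div]
      linarith
    · filter_upwards [eventually_ge_atTop 1] with M hM
      have := ((h M hM).le_leafCount_and_codeMean_le hp₀ hp₁).2
      simp only [Function.comp_apply]
      linarith
  -- The logarithm of `M e^{-t} → 1/H` reads `t = ln M + ln H + o(1)`, which eliminates `t` from the
  -- mean depth.
  have h3 := ((Real.continuousAt_log (one_div_pos.2 hH).ne').tendsto.comp h1).div_const (entropy p)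
  have h4 := h2.sub (h3.add (tendsto_const_nhds (x := Real.log (entropy p) / entropy p)))
  have h5 := h4.sub (tendsto_const_nhds (x := entropy₂ p / (2 * entropy p ^ 2)))
  rw [one_div, Real.log_inv] at h5
  have e0 : entropy₂ p / (2 * entropy p ^ 2) - (-Real.log (entropy p) / entropy p +
      Real.log (entropy p) / entropy p) - entropy₂ p / (2 * entropy p ^ 2) = 0 := by ring
  rw [e0] at h5
  refine h5.congr' ?_
  filter_upwards [eventually_ge_atTop 1] with M hM
  have hM0 : (M : ℝ) ≠ 0 := by positivity
  simp only [Function.comp_apply]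
  rw [Real.log_mul hM0 (Real.exp_pos _).ne', Real.log_exp]
  ring

/-- The function `y ↦ (e^{dy} - 1)/(e^d - 1)` on `[0, 1]`, extended so that the difference with
the identity is periodic, is close to the function itself near `[0, 1]`. -/
theorem abs_sub_floor_sub_fract_le {d z u v : ℝ} (hd : 0 < d) (hz₁ : -1 ≤ z) (hz₂ : z < 2)
    (hu : u ≤ Real.exp (d * z)) (hv : Real.exp (d * (z - 1)) ≤ v) :
    |(Real.exp (d * z) - 1) / (Real.exp d - 1) - ⌊z⌋ -
      (Real.exp (d * Int.fract z) - 1) / (Real.exp d - 1)| ≤ |u - 1| + |v - 1| := by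
  have hd1 : Real.exp d - 1 ≠ 0 := by linarith [Real.one_lt_exp_iff.2 hd]
  have e1 : Real.exp (d * z) = Real.exp (d * (z - 1)) * Real.exp d := by
    rw [← Real.exp_add]; congr 1; ring
  have hu' := neg_abs_le (u - 1)
  have hv' := le_abs_self (v - 1)
  have hu0 := abs_nonneg (u - 1)
  have hv0 := abs_nonneg (v - 1)
  rcases lt_or_ge z 0 with h0 | h0
  -- For `z < 0` the discrepancy is exactly `1 - e^{dz} ≤ 1 - u`; for `z ≥ 1` it is `e^{d(z-1)} - 1
  -- ≤ v - 1`; in between it vanishes.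
  · have hfl : ⌊z⌋ = -1 := by rw [Int.floor_eq_iff]; push_cast; constructor <;> linarith
    have e2 : Real.exp (d * (z + 1)) = Real.exp (d * z) * Real.exp d := by
      rw [← Real.exp_add]; congr 1; ring
    have hle : Real.exp (d * z) ≤ 1 := Real.exp_le_one_iff.2 (mul_nonpos_of_nonneg_of_nonpos hd.le h0.le)
    have e3 : (Real.exp (d * z) - 1) / (Real.exp d - 1) - ⌊z⌋ -
      (Real.exp (d * Int.fract z) - 1) / (Real.exp d - 1) = 1 - Real.exp (d * z) := by
      rw [Int.fract, hfl]
      push_cast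
      rw [sub_neg_eq_add, sub_neg_eq_add, e2]
      field_simp
      ring
    rw [e3, abs_of_nonneg (by linarith)]
    linarith
  · rcases lt_or_ge z 1 with h1 | h1
    · have hfl : ⌊z⌋ = 0 := by rw [Int.floor_eq_iff]; push_cast; constructor <;> linarith
      rw [Int.fract, hfl]
      simp only [Int.cast_zero, sub_zero, sub_self, abs_zero]
      positivity
    · have hfl : ⌊z⌋ = 1 := by rw [Int.floor_eq_iff]; push_cast; constructor <;> linarith
      have hge : 1 ≤ Real.exp (d * (z - 1)) := Real.one_le_exp (mul_nonneg hd.le (by linarith))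
      have e3 : (Real.exp (d * z) - 1) / (Real.exp d - 1) - ⌊z⌋ -
        (Real.exp (d * Int.fract z) - 1) / (Real.exp d - 1) = Real.exp (d * (z - 1)) - 1 := by
        rw [Int.fract, hfl]
        push_cast
        rw [e1]
        field_simp
        ring
      rw [e3, abs_of_nonneg (by linarith)]
      linarith

/-- From `2 sinh(d/2) = e^{d/2} (1 - e^{-d})`. This merges the `sinh` term with the constant inside
the fractional part. -/
theorem log_mul_add_log_sinh_div {d H : ℝ} (hd : 0 < d) (hH : 0 < H) :
    Real.log H + Real.log (Real.sinh (d / 2) / (d / 2)) =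
      d / 2 + Real.log (H * (1 - Real.exp (-d)) / d) := by
  have h1 : 0 < 1 - Real.exp (-d) := by linarith [Real.exp_lt_one_iff.2 (neg_lt_zero.2 hd)]
  have h2 : 0 < Real.sinh (d / 2) / (d / 2) := by
    have := Real.sinh_pos_iff.2 (half_pos hd)
    positivity
  rw [← Real.log_mul hH.ne' h2.ne', ← Real.log_exp (d / 2), ← Real.log_mul (Real.exp_pos _).ne'
    (by positivity), Real.log_exp]
  congr 1
  have e : Real.exp (-(d / 2)) = Real.exp (d / 2) * Real.exp (-d) := by
    rw [← Real.exp_add]; congr 1; ring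
  rw [Real.sinh_eq, e]
  field_simp

/-- The expected phrase length of a code with `M` phrases, in the lattice case. The error is
expressed by the errors in the renewal theorem at the threshold and one step before. -/
theorem IsKhodak.abs_codeMean_sub_le {M : ℕ} {D I : Finset (List Bool)} {t : ℝ} (hp₀ : 0 < p)
    (hp₁ : p < 1) (hKh : IsKhodak p M D I t) {d H κ C g₁ g₂ : ℝ} (hd : 0 < d) (hH : 0 < H)
    {k l : ℕ} (hk : letterCost p true = k * d) (hl : letterCost p false = l * d)
    (hκ : κ = d / (1 - Real.exp (-d)) / H)
    (hC : C = entropy₂ p / (2 * H ^ 2) + d / (2 * H))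
    (hg₁ : g₁ = Real.exp (-latticeFloor d (t - d)) * leafCount p (t - d))
    (hg₂ : g₂ = Real.exp (-latticeFloor d t) * leafCount p t)
    (huM : Real.exp (-d) < g₁ / κ) (hvM : g₂ / κ < Real.exp d) :
    |codeMean p D - (Real.log M / H + Real.log H / H + entropy₂ p / (2 * H ^ 2)
        + 1 / H * Real.log (Real.sinh (d / 2) / (d / 2))
        + d / H * psi d (Int.fract ((Real.log M + Real.log (H * (1 - Real.exp (-d)) / d)) / d)))| ≤
      |meanDepth p (t - d) - latticeFloor d (t - d) / H - C| + Real.exp (-d) * |κ - g₁| +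
        d / H * (|g₁ / κ - 1| + |g₂ / κ - 1|) := by
  have hE1 : 0 < 1 - Real.exp (-d) := by linarith [Real.exp_lt_one_iff.2 (neg_lt_zero.2 hd)]
  have hd1 : 0 < Real.exp d - 1 := by linarith [Real.one_lt_exp_iff.2 hd]
  have hκ0 : 0 < κ := by rw [hκ]; positivity
  obtain ⟨α, hα⟩ := hKh.exists_wordCost
  obtain ⟨n, hn⟩ := exists_wordCost_eq_mul hk hl α
  have htn : t = n * d := by rw [← hα, hn]
  have hfl : latticeFloor d (t) = t := by
    rw [htn]; exact_mod_cast latticeFloor_intCast_mul hd n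
  have hfl' : latticeFloor d (t - d) = t - d := by
    have := latticeFloor_sub_intCast_mul hd (t) 1
    rw [hfl] at this
    simpa using this
  have hgap : ∀ w, wordCost p w < t → wordCost p w ≤ t - d := by
    intro w hw
    obtain ⟨r, hr⟩ := exists_wordCost_eq_mul hk hl w
    rw [hr, htn] at hw
    have hrn : r < n := by exact_mod_cast lt_of_mul_lt_mul_right hw hd.le
    have : (r : ℝ) + 1 ≤ n := by exact_mod_cast hrn
    have := mul_le_mul_of_nonneg_right this hd.le
    rw [hr, htn]
    linarith
  have hlt : t - d < t := by linarith
  have hcode := hKh.codeMean_eq hp₀ hp₁ hlt hgap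
  have hM₁ := (hKh.leafCount_le_and_le_codeMean hp₀ hp₁ hlt).1
  have hM₂ := (hKh.le_leafCount_and_codeMean_le hp₀ hp₁).1
  have hM0 := hKh.card_pos
  set x := (Real.log M + Real.log (H * (1 - Real.exp (-d)) / d)) / d with hx
  -- Here `e^{dz} = M e^{-(t-d)} / κ`. As `M` lies between the leaf counts at `t - d` and `t`, about
  -- `κ e^{t-d}` and `κ e^t`, the number `z` is nearly in `[0, 1]`. It measures the progress of the
  -- code from one lattice threshold to the next.
  set z := x - (n - 1) with hz
  have hκlog : Real.log (H * (1 - Real.exp (-d)) / d) = -Real.log κ := by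
    rw [← Real.log_inv, hκ]; congr 1; field_simp
  have hdx : d * x = Real.log M - Real.log κ := by
    rw [hx, hκlog]; field_simp; ring
  have hdz : d * z = Real.log M - Real.log κ - (t - d) := by
    rw [hz, mul_sub, hdx, htn]; ring
  have hexpz : Real.exp (d * z) = M * Real.exp (-(t - d)) / κ := by
    rw [hdz, sub_eq_add_neg, Real.exp_add, Real.exp_sub, Real.exp_log hM0, Real.exp_log hκ0]
    ring
  have hexpz' : Real.exp (d * (z - 1)) = M * Real.exp (-t) / κ := by
    rw [mul_sub, hdz, show Real.log M - Real.log κ - (t - d) - d * 1 =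
      Real.log M - Real.log κ + -t by ring, Real.exp_add, Real.exp_sub, Real.exp_log hM0,
      Real.exp_log hκ0]
    ring
  have huz : g₁ / κ ≤ Real.exp (d * z) := by
    rw [hexpz, hg₁, hfl']
    rw [mul_comm (M : ℝ)]
    gcongr
  have hvz : Real.exp (d * (z - 1)) ≤ g₂ / κ := by
    rw [hexpz', hg₂, hfl]
    rw [mul_comm (M : ℝ)]
    gcongr
  have hz₁ : -1 ≤ z := by
    have := Real.exp_lt_exp.1 (huM.trans_le huz)
    refine le_of_mul_le_mul_left ?_ hd
    linarith
  have hz₂ : z < 2 := by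
    have := Real.exp_lt_exp.1 (hvz.trans_lt hvM)
    refine lt_of_mul_lt_mul_left ?_ hd.le
    linarith
  have hkey := abs_sub_floor_sub_fract_le hd hz₁ hz₂ huz hvz
  have hfract : Int.fract z = Int.fract x := by
    rw [hz, show x - ((n : ℝ) - 1) = x - ((n - 1 : ℤ) : ℝ) by push_cast; ring,
      Int.fract_sub_intCast]
  have hfloor : (⌊z⌋ : ℝ) = ⌊x⌋ - (n - 1) := by
    rw [hz, show x - ((n : ℝ) - 1) = x - ((n - 1 : ℤ) : ℝ) by push_cast; ring,
      Int.floor_sub_intCast]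
    push_cast; ring
  rw [hfract, hfloor] at hkey
  have hsinh := log_mul_add_log_sinh_div hd hH
  rw [hκlog] at hsinh
  have hg₁' : g₁ = Real.exp (-(t - d)) * leafCount p (t - d) := by
    rw [hg₁, hfl']
  have hexpt : Real.exp (-t) = Real.exp (-d) * Real.exp (-(t - d)) := by
    rw [← Real.exp_add]; congr 1; ring
  have hMκ : M * Real.exp (-(t - d)) = κ * Real.exp (d * z) := by
    rw [hexpz]; field_simp
  have hκd : Real.exp (-d) * κ = d / H / (Real.exp d - 1) := by
    have e : Real.exp d * Real.exp (-d) = 1 := by rw [← Real.exp_add]; simp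
    rw [hκ]
    field_simp
    linear_combination e
  have hfr : Int.fract x = x - ⌊x⌋ := rfl
  have hformula : Real.log M / H + Real.log H / H + entropy₂ p / (2 * H ^ 2)
        + 1 / H * Real.log (Real.sinh (d / 2) / (d / 2)) + d / H * psi d (Int.fract x) =
      C + d / H * (⌊x⌋ + (Real.exp (d * Int.fract x) - 1) / (Real.exp d - 1)) := by
    rw [psi]
    nth_rewrite 2 [hfr]
    have e1 : Real.log M = d * x + Real.log κ := by rw [hdx]; ring
    have e2 : Real.log (Real.sinh (d / 2) / (d / 2)) = d / 2 - Real.log κ - Real.log H :=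
      eq_sub_of_add_eq (by rw [add_comm, hsinh]; ring)
    rw [e1, e2, hC]
    ring
  -- Beyond threshold `t - d` all internal nodes have probability `e^{-t}`, so the mean is linear in
  -- `M`, that is, in `e^{dz}`.
  have hcode' : codeMean p D = (meanDepth p (t - d) - latticeFloor d (t - d) / H - C) + C +
      d / H * (n - 1 + (Real.exp (d * z) - 1) / (Real.exp d - 1)) +
      Real.exp (-d) * (κ - g₁) := by
    rw [hcode, hexpt, hfl', htn]
    rw [htn] at hMκ hg₁'
    have e3 : d / H * ((Real.exp (d * z) - 1) / (Real.exp d - 1)) =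
        Real.exp (-d) * κ * (Real.exp (d * z) - 1) := by rw [hκd]; ring
    rw [mul_add, e3, hg₁']
    linear_combination Real.exp (-d) * hMκ
  rw [hformula, hcode']
  set A := meanDepth p (t - d) - latticeFloor d (t - d) / H - C
  have hsplit : A + C + d / H * (n - 1 + (Real.exp (d * z) - 1) / (Real.exp d - 1)) +
      Real.exp (-d) * (κ - g₁) -
      (C + d / H * (⌊x⌋ + (Real.exp (d * Int.fract x) - 1) / (Real.exp d - 1))) =
      A + Real.exp (-d) * (κ - g₁) + d / H * ((Real.exp (d * z) - 1) / (Real.exp d - 1) -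
        (⌊x⌋ - (n - 1)) - (Real.exp (d * Int.fract x) - 1) / (Real.exp d - 1)) := by ring
  rw [hsplit]
  refine (abs_add_three _ _ _).trans ?_
  rw [abs_mul, abs_mul, abs_of_pos (Real.exp_pos _), abs_of_pos (div_pos hd hH)]
  gcongr

theorem tendsto_codeMean_of_not_irrational (hp₀ : 0 < p) (hp₁ : p < 1)
    (h : ∀ M, 1 ≤ M → IsKhodak p M (𝒟 M) (I M) (t M))
    (hrat : ¬ Irrational (Real.log p / Real.log (1 - p))) {H d : ℝ} (hHe : H = entropy p)
    (hds : d = Tunstall.span p) :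
    Tendsto (fun M : ℕ => codeMean p (𝒟 M) -
      (Real.log M / H + Real.log H / H + entropy₂ p / (2 * H ^ 2)
        + 1 / H * Real.log (Real.sinh (d / 2) / (d / 2))
        + d / H * psi d (Int.fract ((Real.log M + Real.log (H * (1 - Real.exp (-d)) / d)) / d))))
      atTop (𝓝 0) := by
  obtain ⟨hd, k, l, hk, hl, hkl⟩ := exists_coprime_letterCost hp₀ hp₁ hrat
  have hH := entropy_pos hp₀ hp₁
  rw [← hHe] at hH
  rw [← hds] at hd hk hl
  have hleaf := tendsto_leafCount_of_lattice hp₀ hp₁ hd hk hl hkl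
  have hmean := tendsto_meanDepth_of_lattice hp₀ hp₁ hd hk hl hkl
  rw [← hHe] at hleaf hmean
  have ht := tendsto_threshold hp₀ hp₁ h
  have htd : Tendsto (fun M => t M - d) atTop atTop := by
    simpa only [sub_eq_add_neg] using ht.atTop_add tendsto_const_nhds
  have hE1 : 0 < 1 - Real.exp (-d) := by linarith [Real.exp_lt_one_iff.2 (neg_lt_zero.2 hd)]
  have hd1 : 0 < Real.exp d - 1 := by linarith [Real.one_lt_exp_iff.2 hd]
  set κ := d / (1 - Real.exp (-d)) / H with hκ
  have hκ0 : 0 < κ := by positivity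
  set C := entropy₂ p / (2 * H ^ 2) + d / (2 * H) with hC
  set g₁ : ℕ → ℝ := fun M => Real.exp (-latticeFloor d (t M - d)) * leafCount p (t M - d) with hg₁
  set g₂ : ℕ → ℝ := fun M => Real.exp (-latticeFloor d (t M)) * leafCount p (t M) with hg₂
  have hl₁ : Tendsto g₁ atTop (𝓝 κ) := hleaf.comp htd
  have hl₂ : Tendsto g₂ atTop (𝓝 κ) := hleaf.comp ht
  have hu : Tendsto (fun M => g₁ M / κ) atTop (𝓝 1) := by
    simpa [div_self hκ0.ne'] using hl₁.div_const κ
  have hv : Tendsto (fun M => g₂ M / κ) atTop (𝓝 1) := by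
    simpa [div_self hκ0.ne'] using hl₂.div_const κ
  have hm : Tendsto (fun M => meanDepth p (t M - d) - latticeFloor d (t M - d) / H - C) atTop
      (𝓝 0) := by
    simpa using (hmean.comp htd).sub_const C
  have hbound : Tendsto (fun M => |meanDepth p (t M - d) - latticeFloor d (t M - d) / H - C| +
      Real.exp (-d) * |κ - g₁ M| + d / H * (|g₁ M / κ - 1| + |g₂ M / κ - 1|)) atTop (𝓝 0) := by
    have e1 := hm.abs
    have e2 := ((tendsto_const_nhds (x := κ)).sub hl₁).abs.const_mul (Real.exp (-d))
    have e3 := ((hu.sub_const 1).abs.add (hv.sub_const 1).abs).const_mul (d / H)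
    simpa using (e1.add e2).add e3
  refine squeeze_zero_norm' ?_ hbound
  have hu1 : Real.exp (-d) < 1 := by linarith
  have hv1 : 1 < Real.exp d := by linarith
  filter_upwards [eventually_ge_atTop 1, hu.eventually_const_lt hu1, hv.eventually_lt_const hv1]
    with M hM huM hvM
  exact (h M hM).abs_codeMean_sub_le hp₀ hp₁ hd hH hk hl hκ hC rfl rfl huM hvM

end Mean

/-! ### The phrase of a random string. -/

/-- The prefix of `x` that belongs to `D`. -/
def phrase (D : Finset (List Bool)) (x : ℕ → Bool) : List Bool :=
  firstLetters x (phraseLength D x)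

@[simp] theorem length_phrase (D : Finset (List Bool)) (x : ℕ → Bool) :
    (phrase D x).length = phraseLength D x := length_firstLetters _ _

theorem IsTunstallCode.phrase_mem {p : ℝ} {M : ℕ} {D : Finset (List Bool)}
    (h : IsTunstallCode p M D) (x : ℕ → Bool) : phrase D x ∈ D :=
  Nat.sInf_mem (s := {n | firstLetters x n ∈ D}) (h.existsUnique_prefix x).exists

theorem IsTunstallCode.eq_phrase {p : ℝ} {M : ℕ} {D : Finset (List Bool)}
    (h : IsTunstallCode p M D) {x : ℕ → Bool} {w : List Bool} (hw : w ∈ D)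
    (hx : firstLetters x w.length = w) : w = phrase D x := by
  have := (h.existsUnique_prefix x).unique (y₁ := w.length) (y₂ := phraseLength D x)
    (by rwa [hx]) (h.phrase_mem x)
  rw [phrase, ← this, hx]

theorem firstLetters_eq_iff {x : ℕ → Bool} {w : List Bool} :
    firstLetters x w.length = w ↔ ∀ i ∈ Finset.range w.length, x i = w.getD i false := by
  constructor
  · intro h i hi
    rw [Finset.mem_range] at hi
    rw [← h]
    simp [firstLetters, hi]
  · intro h
    refine List.ext_getElem (by simp) fun i h1 h2 => ?_
    have := h i (Finset.mem_range.2 h2)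
    simp [firstLetters, this, h2]

theorem wordProb_eq_prod (p : ℝ) (w : List Bool) :
    wordProb p w = ∏ i ∈ Finset.range w.length, letterProb p (w.getD i false) := by
  induction w with
  | nil => simp
  | cons b w ih =>
    rw [wordProb_cons, List.length_cons, Finset.prod_range_succ', ih, mul_comm]
    simp

theorem wordCost_firstLetters (p : ℝ) (x : ℕ → Bool) (n : ℕ) :
    wordCost p (firstLetters x n) = ∑ i ∈ Finset.range n, letterCost p (x i) := by
  induction n with
  | zero => simp [firstLetters]
  | succ n ih => rw [firstLetters_succ, wordCost_append, ih, Finset.sum_range_succ]; simp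

theorem setOf_firstLetters_eq {Ω : Type*} (ξ : ℕ → Ω → Bool) (w : List Bool) :
    {ω | firstLetters (fun i => ξ i ω) w.length = w} =
      ⋂ i ∈ Finset.range w.length, ξ i ⁻¹' {w.getD i false} := by
  ext ω
  simp only [Set.mem_ofPred_eq, firstLetters_eq_iff, Set.mem_iInter, Set.mem_preimage,
    Set.mem_singleton_iff]

/-- Exactly one phrase is a prefix, so exactly one indicator is nonzero. Measurability and
expectations of functions of the phrase thus reduce to finitely many cylinder events. -/
theorem comp_phrase_eq {Ω E : Type*} [AddCommMonoid E] {p : ℝ} {M : ℕ} {D : Finset (List Bool)}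
    (hD : IsTunstallCode p M D) (ξ : ℕ → Ω → Bool) (f : List Bool → E) (ω : Ω) :
    f (phrase D fun i => ξ i ω) =
      ∑ w ∈ D, {ω | firstLetters (fun i => ξ i ω) w.length = w}.indicator (fun _ => f w) ω := by
  rw [Finset.sum_eq_single (phrase D fun i => ξ i ω)]
  · rw [Set.indicator_of_mem]
    simp [phrase]
  · intro w hw hne
    rw [Set.indicator_of_notMem]
    exact fun hx => hne (hD.eq_phrase hw hx)
  · exact fun hn => absurd (hD.phrase_mem _) hn

/-- The letters `ξ 0, ξ 1, …` are independent, and `1` with probability `p`. -/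
structure IsMemorylessSource {Ω : Type*} [MeasurableSpace Ω] (μ : Measure Ω) (p : ℝ)
    (ξ : ℕ → Ω → Bool) : Prop where
  measurable : ∀ i, Measurable (ξ i)
  indep : iIndepFun ξ μ
  law : ∀ i, μ {ω | ξ i ω = true} = ENNReal.ofReal p

namespace IsMemorylessSource

variable {Ω : Type*} [MeasurableSpace Ω] {μ : Measure Ω} {p : ℝ} {ξ : ℕ → Ω → Bool}

theorem measure_preimage_singleton [IsProbabilityMeasure μ] (h : IsMemorylessSource μ p ξ) (hp₀ : 0 < p) (i : ℕ)
    (b : Bool) : μ (ξ i ⁻¹' {b}) = ENNReal.ofReal (letterProb p b) := by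
  cases b
  · have e : ξ i ⁻¹' {false} = {ω | ξ i ω = true}ᶜ := by ext ω; simp
    have hm : MeasurableSet {ω | ξ i ω = true} := h.measurable i (measurableSet_singleton true)
    rw [e, prob_compl_eq_one_sub hm, h.law,
      letterProb_false, ENNReal.ofReal_sub _ hp₀.le, ENNReal.ofReal_one]
  · rw [letterProb_true]; exact h.law i

theorem measurableSet_firstLetters_eq (h : IsMemorylessSource μ p ξ) (w : List Bool) :
    MeasurableSet {ω | firstLetters (fun i => ξ i ω) w.length = w} := by
  rw [setOf_firstLetters_eq]
  exact Finset.measurableSet_biInter _ fun i _ => h.measurable i (measurableSet_singleton _)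

theorem measureReal_firstLetters_eq [IsProbabilityMeasure μ] (h : IsMemorylessSource μ p ξ) (hp₀ : 0 < p) (hp₁ : p < 1)
    (w : List Bool) :
    μ.real {ω | firstLetters (fun i => ξ i ω) w.length = w} = wordProb p w := by
  rw [setOf_firstLetters_eq, measureReal_def,
    h.indep.measure_inter_preimage_eq_mul _ fun _ _ => measurableSet_singleton _,
    ENNReal.toReal_prod, wordProb_eq_prod]
  refine Finset.prod_congr rfl fun i _ => ?_
  rw [h.measure_preimage_singleton hp₀, ENNReal.toReal_ofReal (letterProb_pos hp₀ hp₁ _).le]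

variable {M : ℕ} {D : Finset (List Bool)}

theorem measurable_comp_phrase {E : Type*} [AddCommMonoid E] [MeasurableSpace E] [MeasurableAdd₂ E]
    (h : IsMemorylessSource μ p ξ) (hD : IsTunstallCode p M D) (f : List Bool → E) :
    Measurable fun ω => f (phrase D fun i => ξ i ω) := by
  simp_rw [comp_phrase_eq hD ξ f]
  exact Finset.measurable_fun_sum _ fun w _ =>
    measurable_const.indicator (h.measurableSet_firstLetters_eq w)

theorem integral_comp_phrase {E : Type*} [NormedAddCommGroup E] [NormedSpace ℝ E]
    [CompleteSpace E] [IsProbabilityMeasure μ] (h : IsMemorylessSource μ p ξ) (hp₀ : 0 < p) (hp₁ : p < 1)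
    (hD : IsTunstallCode p M D) (f : List Bool → E) :
    ∫ ω, f (phrase D fun i => ξ i ω) ∂μ = ∑ w ∈ D, wordProb p w • f w := by
  simp_rw [comp_phrase_eq hD ξ f]
  rw [integral_finsetSum]
  · refine Finset.sum_congr rfl fun w _ => ?_
    rw [integral_indicator_const _ (h.measurableSet_firstLetters_eq w),
      h.measureReal_firstLetters_eq hp₀ hp₁]
  · exact fun w _ => (integrable_const _).indicator (h.measurableSet_firstLetters_eq w)

theorem integral_letterCost [IsProbabilityMeasure μ] (h : IsMemorylessSource μ p ξ) (hp₀ : 0 < p) (hp₁ : p < 1) (i : ℕ) :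
    ∫ ω, letterCost p (ξ i ω) ∂μ = entropy p := by
  rw [← integral_map (φ := ξ i) (h.measurable i).aemeasurable
    (f := letterCost p) (by fun_prop), integral_fintype (.of_finite), Fintype.sum_bool, entropy_eq,
    map_measureReal_apply (h.measurable i) (measurableSet_singleton _),
    map_measureReal_apply (h.measurable i) (measurableSet_singleton _), measureReal_def,
    measureReal_def, h.measure_preimage_singleton hp₀, h.measure_preimage_singleton hp₀,
    ENNReal.toReal_ofReal (letterProb_pos hp₀ hp₁ _).le,
    ENNReal.toReal_ofReal (letterProb_pos hp₀ hp₁ _).le, letterProb_true, letterProb_false]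
  simp

/-- The law of large numbers for the costs of the prefixes of the random string. -/
theorem tendsto_wordCost_div [IsProbabilityMeasure μ] (h : IsMemorylessSource μ p ξ) (hp₀ : 0 < p) (hp₁ : p < 1) :
    ∀ᵐ ω ∂μ, Tendsto (fun n : ℕ => wordCost p (firstLetters (fun i => ξ i ω) n) / n) atTop
      (𝓝 (entropy p)) := by
  have hmeas : ∀ i, Measurable fun ω => letterCost p (ξ i ω) := fun i =>
    (measurable_of_finite (letterCost p)).comp (h.measurable i)
  have hident : ∀ i, IdentDistrib (ξ i) (ξ 0) μ μ := fun i =>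
    ⟨(h.measurable i).aemeasurable, (h.measurable 0).aemeasurable, by
      refine Measure.ext_of_singleton fun b => ?_
      rw [Measure.map_apply (h.measurable i) (measurableSet_singleton b),
        Measure.map_apply (h.measurable 0) (measurableSet_singleton b),
        h.measure_preimage_singleton hp₀, h.measure_preimage_singleton hp₀]⟩
  have hint : Integrable (fun ω => letterCost p (ξ 0 ω)) μ := by
    refine Integrable.of_bound (hmeas 0).aestronglyMeasurable
      (letterCost p true + letterCost p false) (.of_forall fun ω => ?_)
    have ha := letterCost_pos hp₀ hp₁ true
    have hb := letterCost_pos hp₀ hp₁ false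
    rw [Real.norm_eq_abs, abs_of_pos (letterCost_pos hp₀ hp₁ _)]
    cases ξ 0 ω <;> linarith
  have := strong_law_ae_real (fun i ω => letterCost p (ξ i ω)) hint
    (fun i j hij => (h.indep.indepFun hij).comp (measurable_of_finite (letterCost p))
      (measurable_of_finite (letterCost p)))
    (fun i => (hident i).comp (measurable_of_finite (letterCost p)))
  rw [h.integral_letterCost hp₀ hp₁] at this
  simpa only [wordCost_firstLetters] using this

end IsMemorylessSource

/-! ### Almost sure convergence. -/

section Deterministic

variable {p : ℝ} {𝒟 I : ℕ → Finset (List Bool)} {t : ℕ → ℝ}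

theorem tendsto_const_div_log (c : ℝ) : Tendsto (fun M : ℕ => c / Real.log M) atTop (𝓝 0) :=
  tendsto_log_natCast.const_div_atTop c

theorem tendsto_wordCost_div_log (hp₀ : 0 < p) (hp₁ : p < 1)
    (h : ∀ M, 1 ≤ M → IsKhodak p M (𝒟 M) (I M) (t M)) {w : ℕ → List Bool}
    (hw : ∀ M, 1 ≤ M → w M ∈ 𝒟 M) :
    Tendsto (fun M : ℕ => wordCost p (w M) / Real.log M) atTop (𝓝 1) := by
  rw [← tendsto_sub_nhds_zero_iff]
  refine squeeze_zero_norm' ?_ (tendsto_const_div_log (letterCost p true + letterCost p false))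
  filter_upwards [eventually_ge_atTop 2] with M hM
  have hlog : 0 < Real.log M := Real.log_pos (by exact_mod_cast hM)
  have := (h M (by omega)).abs_wordCost_sub_log_le hp₀ hp₁ (hw M (by omega))
  rw [Real.norm_eq_abs, div_sub_one hlog.ne', abs_div, abs_of_pos hlog]
  gcongr

theorem tendsto_length_atTop (hp₀ : 0 < p) (hp₁ : p < 1)
    (h : ∀ M, 1 ≤ M → IsKhodak p M (𝒟 M) (I M) (t M)) {w : ℕ → List Bool}
    (hw : ∀ M, 1 ≤ M → w M ∈ 𝒟 M) : Tendsto (fun M => (w M).length) atTop atTop := by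
  have ha := letterCost_pos hp₀ hp₁ true
  have hb := letterCost_pos hp₀ hp₁ false
  set c := letterCost p true + letterCost p false with hc
  rw [← tendsto_natCast_atTop_iff (R := ℝ)]
  have h1 := (tendsto_log_natCast.atTop_add (tendsto_const_nhds (x := -c))).atTop_div_const
    (show 0 < c by positivity)
  refine tendsto_atTop_mono' _ ?_ h1
  filter_upwards [eventually_ge_atTop 1] with M hM
  have h2 := (abs_le.1 ((h M hM).abs_wordCost_sub_log_le hp₀ hp₁ (hw M hM))).1
  have h3 := wordCost_le_length_mul (p := p) (m := c) (fun b => by cases b <;> linarith) (w M)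
  rw [div_le_iff₀ (by positivity)]
  linarith

end Deterministic

/-- For almost every string, divide cost over `ln M`, which tends to `1`, by cost over length, which
tends to `H` because the lengths tend to infinity. -/
theorem IsMemorylessSource.tendsto_length_div_log {Ω : Type*} [MeasurableSpace Ω] {μ : Measure Ω}
    [IsProbabilityMeasure μ] {p : ℝ} {ξ : ℕ → Ω → Bool} {𝒟 I : ℕ → Finset (List Bool)} {t : ℕ → ℝ}
    (hξ : IsMemorylessSource μ p ξ) (hp₀ : 0 < p) (hp₁ : p < 1)
    (h𝒟 : ∀ M, 1 ≤ M → IsTunstallCode p M (𝒟 M))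
    (h : ∀ M, 1 ≤ M → IsKhodak p M (𝒟 M) (I M) (t M)) :
    ∀ᵐ ω ∂μ, Tendsto (fun M : ℕ => (phraseLength (𝒟 M) (fun i => ξ i ω) : ℝ) / Real.log M) atTop
      (𝓝 (1 / entropy p)) := by
  filter_upwards [hξ.tendsto_wordCost_div hp₀ hp₁] with ω hω
  have hw : ∀ M, 1 ≤ M → phrase (𝒟 M) (fun i => ξ i ω) ∈ 𝒟 M := fun M hM =>
    (h𝒟 M hM).phrase_mem _
  have h1 := tendsto_wordCost_div_log hp₀ hp₁ h hw
  have h2 := tendsto_length_atTop hp₀ hp₁ h hw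
  simp only [length_phrase] at h2
  have h3 := h1.div (hω.comp h2) (entropy_pos hp₀ hp₁).ne'
  refine h3.congr' ?_
  filter_upwards [h1.eventually_ne one_ne_zero, h2.eventually_ge_atTop 1] with M hM1 hM2
  have hM3 : (phraseLength (𝒟 M) (fun i => ξ i ω) : ℝ) ≠ 0 := by positivity
  simp only [Function.comp_apply, Pi.div_apply]
  rw [← phrase]
  have hS : wordCost p (phrase (𝒟 M) fun i => ξ i ω) ≠ 0 := fun h0 => hM1 (by rw [h0, zero_div])
  field_simp

/-! ### Wald's identities and the variance. -/

section Variance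

variable {p : ℝ}

/-- Wald's first identity: splitting a leaf raises the expected cost by `H` times its probability.
-/
theorem GrowsTree.sum_wordCost {I D : Finset (List Bool)} (h : GrowsTree I D) :
    ∑ w ∈ D, wordProb p w * wordCost p w = entropy p * codeMean p D := by
  rw [h.codeMean_eq, h.sum_leaves (g := fun w => entropy p * wordProb p w) fun w => ?_,
    Finset.mul_sum]
  · simp
  · simp only [wordProb_append, wordCost_append, wordProb_cons, wordProb_nil, wordCost_cons,
      wordCost_nil, letterProb_true, letterProb_false, entropy_eq]
    ring

/-- Wald's second identity. -/
theorem GrowsTree.sum_sq {I D : Finset (List Bool)} (h : GrowsTree I D) :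
    ∑ w ∈ D, wordProb p w * (wordCost p w - entropy p * w.length) ^ 2 =
      sigmaSq p * codeMean p D := by
  rw [h.codeMean_eq, h.sum_leaves (g := fun w => sigmaSq p * wordProb p w) fun w => ?_,
    Finset.mul_sum]
  · simp
  · simp only [wordProb_append, wordCost_append, wordProb_cons, wordProb_nil, wordCost_cons,
      wordCost_nil, letterProb_true, letterProb_false, entropy_eq, sigmaSq, entropy₂_eq,
      List.length_append, List.length_cons, List.length_nil]
    push_cast
    ring

/-- The variance of the length of the phrase of a random string. -/
def codeVar (p : ℝ) (D : Finset (List Bool)) : ℝ :=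
  ∑ w ∈ D, wordProb p w * (w.length - codeMean p D) ^ 2

/-- A bounded perturbation barely affects a large second moment: `(f - g)² - g² = f² - 2fg` and
`2|fg| ≤ f²/ε + ε g²`. -/
theorem sum_mul_sub_sq_le {ι : Type*} {s : Finset ι} {P f g : ι → ℝ} {c ε : ℝ}
    (hP : ∀ i ∈ s, 0 ≤ P i) (hP1 : ∑ i ∈ s, P i = 1) (hf : ∀ i ∈ s, |f i| ≤ c) (hε : 0 < ε) :
    |∑ i ∈ s, P i * (f i - g i) ^ 2 - ∑ i ∈ s, P i * g i ^ 2| ≤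
      c ^ 2 * (1 + 1 / ε) + ε * ∑ i ∈ s, P i * g i ^ 2 := by
  rw [← Finset.sum_sub_distrib]
  calc |∑ i ∈ s, (P i * (f i - g i) ^ 2 - P i * g i ^ 2)|
      ≤ ∑ i ∈ s, |P i * (f i - g i) ^ 2 - P i * g i ^ 2| := Finset.abs_sum_le_sum_abs _ _
    _ ≤ ∑ i ∈ s, (P i * (c ^ 2 * (1 + 1 / ε)) + ε * (P i * g i ^ 2)) := by
        refine Finset.sum_le_sum fun i hi => ?_
        rw [← mul_sub, abs_mul, abs_of_nonneg (hP i hi),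
          show P i * (c ^ 2 * (1 + 1 / ε)) + ε * (P i * g i ^ 2) =
            P i * (c ^ 2 * (1 + 1 / ε) + ε * g i ^ 2) by ring]
        refine mul_le_mul_of_nonneg_left ?_ (hP i hi)
        have hfc : f i ^ 2 ≤ c ^ 2 := sq_le_sq' (abs_le.1 (hf i hi)).1 (abs_le.1 (hf i hi)).2
        have h1 : 2 * |f i * g i| ≤ f i ^ 2 * (1 / ε) + ε * g i ^ 2 := by
          have := sq_nonneg (|f i| - ε * |g i|)
          rw [abs_mul, ← sq_abs (f i), ← sq_abs (g i), mul_one_div, ← sub_le_iff_le_add,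
            le_div_iff₀ hε]
          linarith
        have h2 : f i ^ 2 * (1 + 1 / ε) ≤ c ^ 2 * (1 + 1 / ε) := by gcongr
        have h3 := abs_le.1 (le_refl |f i * g i|)
        rw [abs_le]
        constructor
        · linarith [sq_nonneg (f i), h3.2]
        · linarith [sq_nonneg (f i), h3.1]
    _ = c ^ 2 * (1 + 1 / ε) + ε * ∑ i ∈ s, P i * g i ^ 2 := by
        rw [Finset.sum_add_distrib, ← Finset.sum_mul, hP1, one_mul, ← Finset.mul_sum]

theorem IsKhodak.abs_codeMean_mul_sub_le {M : ℕ} {D I : Finset (List Bool)} {t : ℝ}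
    (h : IsKhodak p M D I t) (hp₀ : 0 < p) (hp₁ : p < 1) :
    |entropy p * codeMean p D - Real.log M| ≤ letterCost p true + letterCost p false := by
  rw [← h.grows.sum_wordCost]
  calc |∑ w ∈ D, wordProb p w * wordCost p w - Real.log M|
      = |∑ w ∈ D, wordProb p w * (wordCost p w - Real.log M)| := by
        simp_rw [mul_sub]
        rw [Finset.sum_sub_distrib, ← Finset.sum_mul, h.grows.sum_wordProb, one_mul]
    _ ≤ ∑ w ∈ D, |wordProb p w * (wordCost p w - Real.log M)| := Finset.abs_sum_le_sum_abs _ _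
    _ ≤ ∑ w ∈ D, wordProb p w * (letterCost p true + letterCost p false) := by
        refine Finset.sum_le_sum fun w hw => ?_
        rw [abs_mul, abs_of_pos (wordProb_pos hp₀ hp₁ w)]
        exact mul_le_mul_of_nonneg_left (h.abs_wordCost_sub_log_le hp₀ hp₁ hw)
          (wordProb_pos hp₀ hp₁ w).le
    _ = letterCost p true + letterCost p false := by
        rw [← Finset.sum_mul, h.grows.sum_wordProb, one_mul]

theorem sigmaSq_nonneg (hp₀ : 0 < p) (hp₁ : p < 1) : 0 ≤ sigmaSq p := by
  rw [sigmaSq_eq hp₀ hp₁]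
  have := sub_pos.2 hp₁
  positivity

/-- Write `H (length - mean)` as (cost - `H` mean) minus (cost - `H` length). The first is bounded
because leaf costs are almost constant; the second moment of the other is given by Wald's second
identity. -/
theorem IsKhodak.abs_codeVar_sub_le {M : ℕ} {D I : Finset (List Bool)} {t : ℝ}
    (h : IsKhodak p M D I t) (hp₀ : 0 < p) (hp₁ : p < 1) {ε : ℝ} (hε : 0 < ε) :
    |entropy p ^ 2 * codeVar p D - sigmaSq p * codeMean p D| ≤
      (2 * (letterCost p true + letterCost p false)) ^ 2 * (1 + 1 / ε) +
        ε * (sigmaSq p * codeMean p D) := by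
  set H := entropy p
  have := sum_mul_sub_sq_le (s := D) (P := wordProb p)
    (f := fun w => wordCost p w - H * codeMean p D)
    (g := fun w => wordCost p w - H * w.length) (c := 2 * (letterCost p true + letterCost p false))
    (fun w _ => (wordProb_pos hp₀ hp₁ w).le) h.grows.sum_wordProb (fun w hw => ?_) hε
  · rw [h.grows.sum_sq] at this
    convert this using 3
    rw [codeVar, Finset.mul_sum]
    refine Finset.sum_congr rfl fun w _ => ?_
    ring
  · have h1 := abs_le.1 (h.abs_wordCost_sub_log_le hp₀ hp₁ hw)
    have h2 := abs_le.1 (h.abs_codeMean_mul_sub_le hp₀ hp₁)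
    rw [abs_le]
    constructor <;> linarith [h1.1, h1.2, h2.1, h2.2]

theorem isLittleO_codeVar {𝒟 I : ℕ → Finset (List Bool)} {t : ℕ → ℝ} (hp₀ : 0 < p) (hp₁ : p < 1)
    (h : ∀ M, 1 ≤ M → IsKhodak p M (𝒟 M) (I M) (t M)) :
    (fun M : ℕ => codeVar p (𝒟 M) - sigmaSq p / entropy p ^ 3 * Real.log M) =o[atTop]
      fun M : ℕ => Real.log M := by
  have hH := entropy_pos hp₀ hp₁
  have hσ := sigmaSq_nonneg hp₀ hp₁
  set H := entropy p
  set σ := sigmaSq p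
  set c := letterCost p true + letterCost p false
  rw [isLittleO_iff]
  intro δ hδ
  -- This spends half of the allowed error on the term `ε σ L / H`; the constants collected in `A`
  -- take the other half once `ln M` is large. The `+ 1` covers `σ = 0`.
  set ε := δ * H ^ 3 / (2 * (σ + 1)) with hε_def
  have hε : 0 < ε := by positivity
  set A := (2 * c) ^ 2 * (1 + 1 / ε) + ε * σ * c / H + σ * c / H with hA
  filter_upwards [eventually_ge_atTop 1, tendsto_log_natCast.eventually_ge_atTop 0,
    tendsto_log_natCast.eventually_ge_atTop (2 * A / (δ * H ^ 2))] with M hM hlog0 hlog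
  have h1 := (h M hM).abs_codeVar_sub_le hp₀ hp₁ hε
  have h2 := (h M hM).abs_codeMean_mul_sub_le hp₀ hp₁
  set m := codeMean p (𝒟 M)
  set V := codeVar p (𝒟 M)
  rw [div_le_iff₀ (by positivity)] at hlog
  rw [Real.norm_eq_abs, Real.norm_eq_abs, abs_of_nonneg hlog0]
  set L := Real.log M
  have h3 : |σ * m - σ * L / H| ≤ σ * c / H := by
    rw [show σ * m - σ * L / H = σ / H * (H * m - L) by field_simp, abs_mul,
      abs_of_nonneg (div_nonneg hσ hH.le), mul_div_right_comm]
    gcongr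
  have h4 : σ * m ≤ σ * c / H + σ * L / H := by linarith [(abs_le.1 h3).2]
  have h5 : ε * (σ * L / H) ≤ δ * H ^ 2 * L / 2 := by
    have : σ / (σ + 1) ≤ 1 := (div_le_one (by positivity)).2 (by linarith)
    calc ε * (σ * L / H) = (σ / (σ + 1)) * (δ * H ^ 2 * L / 2) := by
          rw [hε_def]; field_simp
      _ ≤ 1 * (δ * H ^ 2 * L / 2) := by gcongr
      _ = _ := one_mul _
  have h6 : ε * (σ * m) ≤ ε * (σ * c / H) + ε * (σ * L / H) := by
    rw [← mul_add]; gcongr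
  have h7 : H ^ 2 * |V - σ / H ^ 3 * L| ≤ H ^ 2 * (δ * L) := by
    calc H ^ 2 * |V - σ / H ^ 3 * L| = |(H ^ 2 * V - σ * m) + (σ * m - σ * L / H)| := by
          rw [← abs_of_pos (show 0 < H ^ 2 by positivity), ← abs_mul,
            abs_of_pos (show 0 < H ^ 2 by positivity)]
          congr 1
          field_simp
          ring
      _ ≤ |H ^ 2 * V - σ * m| + |σ * m - σ * L / H| := abs_add_le _ _
      _ ≤ A + δ * H ^ 2 * L / 2 := by
          have : ε * σ * c / H = ε * (σ * c / H) := by ring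
          linarith
      _ ≤ H ^ 2 * (δ * L) := by linarith
  exact le_of_mul_le_mul_left h7 (by positivity)

end Variance

theorem IsMemorylessSource.variance_phraseLength {Ω : Type*} [MeasurableSpace Ω] {μ : Measure Ω}
    [IsProbabilityMeasure μ] {p : ℝ} {ξ : ℕ → Ω → Bool} {M : ℕ} {D : Finset (List Bool)}
    (hξ : IsMemorylessSource μ p ξ) (hp₀ : 0 < p) (hp₁ : p < 1) (hD : IsTunstallCode p M D) :
    ∫ ω, (phraseLength D (fun i => ξ i ω) : ℝ) ∂μ = codeMean p D ∧
      Var[fun ω => (phraseLength D (fun i => ξ i ω) : ℝ); μ] = codeVar p D := by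
  have h1 : ∫ ω, (phraseLength D (fun i => ξ i ω) : ℝ) ∂μ = codeMean p D := by
    have := hξ.integral_comp_phrase hp₀ hp₁ hD (fun w => (w.length : ℝ))
    simpa only [length_phrase, smul_eq_mul, codeMean] using this
  have hmeas := hξ.measurable_comp_phrase hD (fun w => (w.length : ℝ))
  simp only [length_phrase] at hmeas
  refine ⟨h1, ?_⟩
  rw [variance_eq_integral hmeas.aemeasurable, h1]
  have := hξ.integral_comp_phrase hp₀ hp₁ hD (fun w => ((w.length : ℝ) - codeMean p D) ^ 2)
  simpa only [length_phrase, smul_eq_mul, codeVar] using this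

/-! ### Characteristic functions and asymptotic normality. -/

section CharFun

variable {p : ℝ}

/-- The characteristic function of the centred cost of a letter. -/
def costCharFun (p θ : ℝ) : ℂ :=
  p * Complex.exp ((θ * (letterCost p true - entropy p) : ℝ) * Complex.I) +
    (1 - p) * Complex.exp ((θ * (letterCost p false - entropy p) : ℝ) * Complex.I)

/-- Wald's fundamental identity. -/
theorem GrowsTree.sum_exp {I D : Finset (List Bool)} (h : GrowsTree I D) {θ : ℝ}
    (hφ : costCharFun p θ ≠ 0) :
    ∑ w ∈ D, wordProb p w • (Complex.exp ((θ * (wordCost p w - entropy p * w.length) : ℝ) *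
      Complex.I) * ((costCharFun p θ) ^ w.length)⁻¹) = 1 := by
  rw [h.sum_leaves (g := fun _ => 0) fun w => ?_]
  · simp
  · have e : ∀ b, Complex.exp ((θ * (wordCost p (w ++ [b]) - entropy p * (w ++ [b]).length) : ℝ) *
        Complex.I) = Complex.exp ((θ * (wordCost p w - entropy p * w.length) : ℝ) * Complex.I) *
        Complex.exp ((θ * (letterCost p b - entropy p) : ℝ) * Complex.I) := by
      intro b
      rw [← Complex.exp_add]
      congr 1
      simp only [wordCost_append, wordCost_cons, wordCost_nil, List.length_append, List.length_cons,
        List.length_nil]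
      push_cast
      ring
    rw [e, e]
    simp only [wordProb_append, wordProb_cons, wordProb_nil, List.length_append, List.length_cons,
      List.length_nil, zero_add, pow_succ, mul_inv, Complex.real_smul, letterProb_true,
      letterProb_false, mul_one, add_zero]
    have hφ' := mul_inv_cancel₀ hφ
    nth_rewrite 1 [costCharFun] at hφ'
    push_cast at hφ' ⊢
    generalize Complex.exp (θ * (letterCost p true - entropy p) * Complex.I) = x₁ at *
    generalize Complex.exp (θ * (letterCost p false - entropy p) * Complex.I) = x₀ at *
    linear_combination (wordProb p w : ℂ) *
      Complex.exp (θ * (wordCost p w - entropy p * w.length) * Complex.I) *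
      ((costCharFun p θ) ^ w.length)⁻¹ * hφ'

theorem tendsto_mul_exp_sub_one_sub (c : ℝ) :
    Tendsto (fun x : ℝ => (x : ℂ) * (Complex.exp ((c / √x : ℝ) * Complex.I) - 1 -
      (c / √x : ℝ) * Complex.I)) atTop (𝓝 (-(c ^ 2 / 2 : ℝ))) := by
  have hs : Tendsto (fun x : ℝ => |c| / √x) atTop (𝓝 0) :=
    Real.tendsto_sqrt_atTop.const_div_atTop _
  have hb : Tendsto (fun x : ℝ => c ^ 2 * (|c| / √x) * Real.exp (|c| / √x)) atTop (𝓝 0) := by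
    have := (hs.const_mul (c ^ 2)).mul ((Real.continuous_exp.tendsto _).comp hs)
    simpa using this
  rw [← tendsto_sub_nhds_zero_iff]
  refine squeeze_zero_norm' ?_ hb
  filter_upwards [eventually_gt_atTop 0] with x hx
  have hx' : 0 < √x := Real.sqrt_pos.2 hx
  have hsq : (√x : ℂ) ^ 2 = x := by exact_mod_cast Real.sq_sqrt hx.le
  have hx0 : (√x : ℂ) ≠ 0 := by exact_mod_cast hx'.ne'
  set z : ℂ := (c / √x : ℝ) * Complex.I with hz
  have hzn : ‖z‖ = |c| / √x := by
    rw [hz, norm_mul, Complex.norm_I, mul_one, Complex.norm_real, Real.norm_eq_abs, abs_div,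
      abs_of_pos hx']
  have hz2 : (x : ℂ) * (z ^ 2 / 2) = -(c ^ 2 / 2 : ℝ) := by
    rw [hz, mul_pow, Complex.I_sq]
    push_cast
    rw [← hsq]
    field_simp
  have h3 := Complex.norm_exp_sub_sum_le_norm_mul_exp z 3
  simp only [Finset.sum_range_succ, Finset.sum_range_zero, Nat.factorial, zero_add, pow_zero,
    pow_one] at h3
  norm_num at h3
  rw [← hz2, show (x : ℂ) * (Complex.exp z - 1 - z) - x * (z ^ 2 / 2) =
    x * (Complex.exp z - (1 + z + z ^ 2 / 2)) by ring, norm_mul, Complex.norm_real,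
    Real.norm_eq_abs, abs_of_pos hx]
  calc x * ‖Complex.exp z - (1 + z + z ^ 2 / 2)‖ ≤ x * (‖z‖ ^ 3 * Real.exp ‖z‖) := by gcongr
    _ = c ^ 2 * (|c| / √x) * Real.exp (|c| / √x) := by
        rw [hzn, ← mul_assoc]
        congr 1
        rw [← sq_abs c, div_pow, pow_succ (√x), Real.sq_sqrt hx.le]
        field_simp

/-- The linear Taylor terms cancel since the cost is centred at its mean `H`; the quadratic ones add
up to the variance `σ²`. -/
theorem tendsto_mul_costCharFun_sub_one (u : ℝ) :
    Tendsto (fun x : ℝ => (x : ℂ) * (costCharFun p (u / √x) - 1)) atTop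
      (𝓝 (-(sigmaSq p * u ^ 2 / 2 : ℝ))) := by
  have h1 := (tendsto_mul_exp_sub_one_sub (u * (letterCost p true - entropy p))).const_mul (p : ℂ)
  have h0 := (tendsto_mul_exp_sub_one_sub (u * (letterCost p false - entropy p))).const_mul
    (1 - p : ℂ)
  have hH : (entropy p : ℂ) = p * letterCost p true + (1 - p) * letterCost p false := by
    exact_mod_cast entropy_eq
  have := h1.add h0
  convert this using 2 with x
  · rw [costCharFun, div_mul_eq_mul_div, div_mul_eq_mul_div]
    generalize Complex.exp _ = x₁
    generalize Complex.exp _ = x₀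
    push_cast
    linear_combination (-x * u / √x * Complex.I) * hH
  · have : sigmaSq p = p * (letterCost p true - entropy p) ^ 2 +
        (1 - p) * (letterCost p false - entropy p) ^ 2 := by
      rw [sigmaSq, entropy₂_eq, entropy_eq]; ring
    rw [this]
    push_cast
    ring

theorem tendsto_costCharFun (u : ℝ) :
    Tendsto (fun x : ℝ => costCharFun p (u / √x)) atTop (𝓝 1) := by
  have hs : Tendsto (fun x : ℝ => u / √x) atTop (𝓝 0) :=
    Real.tendsto_sqrt_atTop.const_div_atTop _
  have hc : Continuous (costCharFun p) := by unfold costCharFun; fun_prop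
  have h0 : costCharFun p 0 = 1 := by simp [costCharFun]
  have := (hc.tendsto 0).comp hs
  rwa [h0] at this

theorem tendsto_mul_log_costCharFun (u : ℝ) :
    Tendsto (fun x : ℝ => (x : ℂ) * Complex.log (costCharFun p (u / √x))) atTop
      (𝓝 (-(sigmaSq p * u ^ 2 / 2 : ℝ))) := by
  have := Complex.tendsto_mul_log_one_add_of_tendsto (tendsto_mul_costCharFun_sub_one (p := p) u)
  simpa using this

end CharFun

theorem IsKhodak.length_le {p : ℝ} {M : ℕ} {D I : Finset (List Bool)} {t : ℝ}
    (h : IsKhodak p M D I t) (hp₀ : 0 < p) (hp₁ : p < 1) {w : List Bool} (hw : w ∈ D) :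
    w.length * min (letterCost p true) (letterCost p false) ≤
      Real.log M + (letterCost p true + letterCost p false) := by
  have h1 := length_mul_le_wordCost (p := p) (m := min (letterCost p true) (letterCost p false))
    (fun b => by cases b; exacts [min_le_right _ _, min_le_left _ _]) w
  linarith [(abs_le.1 (h.abs_wordCost_sub_log_le hp₀ hp₁ hw)).2]

namespace IsMemorylessSource

variable {Ω : Type*} [MeasurableSpace Ω] {μ : Measure Ω} [IsProbabilityMeasure μ] {p : ℝ}
  {ξ : ℕ → Ω → Bool} {𝒟 I : ℕ → Finset (List Bool)} {t : ℕ → ℝ}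

/-- The central limit theorem for the difference of the cost of the phrase and `H` times its
length, in terms of characteristic functions. -/
theorem tendsto_integral_exp_wordCost_sub (hξ : IsMemorylessSource μ p ξ) (hp₀ : 0 < p)
    (hp₁ : p < 1) (h𝒟 : ∀ M, 1 ≤ M → IsTunstallCode p M (𝒟 M))
    (h : ∀ M, 1 ≤ M → IsKhodak p M (𝒟 M) (I M) (t M)) (u : ℝ) :
    Tendsto (fun M : ℕ => ∫ ω, Complex.exp ((u / √(Real.log M) *
      (wordCost p (phrase (𝒟 M) fun i => ξ i ω) -
        entropy p * (phrase (𝒟 M) fun i => ξ i ω).length) : ℝ) * Complex.I) ∂μ) atTop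
      (𝓝 (Complex.exp (-(sigmaSq p * u ^ 2 / (2 * entropy p) : ℝ)))) := by
  have hH := entropy_pos hp₀ hp₁
  set c := letterCost p true + letterCost p false
  set m := min (letterCost p true) (letterCost p false) with hm_def
  have hm : 0 < m := lt_min (letterCost_pos hp₀ hp₁ _) (letterCost_pos hp₀ hp₁ _)
  set v : ℝ := sigmaSq p * u ^ 2 / (2 * entropy p) with hv
  set φ : ℕ → ℂ := fun M => costCharFun p (u / √(Real.log M)) with hφ
  have hφ1 : Tendsto φ atTop (𝓝 1) := (tendsto_costCharFun u).comp tendsto_log_natCast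
  have hlogφ : Tendsto (fun M : ℕ => (Real.log M : ℂ) * Complex.log (φ M)) atTop
      (𝓝 (-(sigmaSq p * u ^ 2 / 2 : ℝ))) :=
    (tendsto_mul_log_costCharFun u).comp tendsto_log_natCast
  set A : ℝ := sigmaSq p * u ^ 2 / 2 + 1 with hA
  have hA0 : 0 < A := by have := sigmaSq_nonneg hp₀ hp₁; positivity
  have hφA : ∀ᶠ M : ℕ in atTop, ‖(Real.log M : ℂ) * Complex.log (φ M)‖ < A := by
    refine hlogφ.norm.eventually_lt_const ?_
    have := sigmaSq_nonneg hp₀ hp₁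
    rw [norm_neg, Complex.norm_real, Real.norm_eq_abs, abs_of_nonneg (by positivity)]
    linarith
  set E : ℕ → List Bool → ℂ := fun M w =>
    Complex.exp ((u / √(Real.log M) * (wordCost p w - entropy p * w.length) : ℝ) * Complex.I)
    with hE
  have hE1 : ∀ M w, ‖E M w‖ = 1 := fun M w => Complex.norm_exp_ofReal_mul_I _
  -- Wald's identity says that `E M w * φ^{-length}` has mean `1`. The random exponent is harmless:
  -- length over `ln M` tends to `1/H` and `ln M * log φ` to `-σ²u²/2`, so `φ^{-length}` tends to
  -- the constant `e^v`. As `|E| = 1`, the mean of `F` tends to `0`, and that of `E` to `e^{-v}`.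
  set F : ℕ → List Bool → ℂ := fun M w =>
    E M w * (((φ M) ^ w.length)⁻¹ - Complex.exp v) with hF
  have hpow : ∀ M, φ M ≠ 0 → ∀ n : ℕ, ((φ M) ^ n)⁻¹ = Complex.exp (-(n * Complex.log (φ M))) := by
    intro M hM n
    rw [Complex.exp_neg, Complex.exp_nat_mul, Complex.exp_log hM]
  have hF0 : Tendsto (fun M => ∫ ω, F M (phrase (𝒟 M) fun i => ξ i ω) ∂μ) atTop (𝓝 0) := by
    rw [← integral_zero Ω ℂ (μ := μ)]
    refine tendsto_integral_filter_of_dominated_convergence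
      -- The length is at most `(2 / m) ln M` as soon as `ln M ≥ c`, and `ln M * |log φ| < A`
      -- eventually.
      (fun _ => Real.exp (2 / m * A) + Real.exp v) ?_ ?_ (integrable_const _) ?_
    · filter_upwards [eventually_ge_atTop 1] with M hM
      exact (hξ.measurable_comp_phrase (h𝒟 M hM) (F M)).aestronglyMeasurable
    · filter_upwards [eventually_ge_atTop 1, hφA, hφ1.eventually_ne one_ne_zero,
        tendsto_log_natCast.eventually_gt_atTop 0, tendsto_log_natCast.eventually_ge_atTop c]
        with M hM hMA hM0 hlog0 hlogc
      refine .of_forall fun ω => ?_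
      have hlen := (h M hM).length_le hp₀ hp₁ ((h𝒟 M hM).phrase_mem fun i => ξ i ω)
      set w := phrase (𝒟 M) fun i => ξ i ω
      have hlen' : (w.length : ℝ) ≤ 2 / m * Real.log M := by
        rw [div_mul_eq_mul_div, le_div_iff₀ hm]; linarith
      simp only [hF]
      rw [norm_mul, hE1, one_mul, hpow M hM0]
      refine (norm_sub_le _ _).trans (add_le_add ?_ (by rw [Complex.norm_exp_ofReal]))
      refine (Complex.norm_exp_le_exp_norm _).trans (Real.exp_le_exp.2 ?_)
      rw [norm_mul, Complex.norm_real, Real.norm_eq_abs, abs_of_pos hlog0] at hMA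
      rw [norm_neg, norm_mul, Complex.norm_natCast]
      calc (w.length : ℝ) * ‖Complex.log (φ M)‖ ≤ 2 / m * Real.log M * ‖Complex.log (φ M)‖ := by
            gcongr
        _ = 2 / m * (Real.log M * ‖Complex.log (φ M)‖) := by ring
        _ ≤ 2 / m * A := by gcongr
    · filter_upwards [hξ.tendsto_length_div_log hp₀ hp₁ h𝒟 h] with ω hω
      have h1 : Tendsto (fun M : ℕ => ((φ M) ^ (phrase (𝒟 M) fun i => ξ i ω).length)⁻¹ -
          Complex.exp v) atTop (𝓝 0) := by
        have h2 : Tendsto (fun M : ℕ =>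
            (((phraseLength (𝒟 M) (fun i => ξ i ω) : ℝ) / Real.log M : ℝ) : ℂ)) atTop
            (𝓝 ((1 / entropy p : ℝ) : ℂ)) := (Complex.continuous_ofReal.tendsto _).comp hω
        have h3 := (h2.mul hlogφ).neg
        have h4 := ((Complex.continuous_exp.tendsto _).comp h3).sub_const (Complex.exp v)
        have e : -(((1 / entropy p : ℝ) : ℂ) * -((sigmaSq p * u ^ 2 / 2 : ℝ) : ℂ)) = (v : ℂ) := by
          rw [hv]; push_cast; ring
        rw [e, sub_self] at h4
        refine h4.congr' ?_
        filter_upwards [hφ1.eventually_ne one_ne_zero, tendsto_log_natCast.eventually_gt_atTop 0]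
          with M hM0 hlog0
        have hlog : (Real.log M : ℂ) ≠ 0 := by exact_mod_cast hlog0.ne'
        simp only [Function.comp_apply]
        rw [hpow M hM0, length_phrase, Complex.ofReal_div]
        congr 3
        rw [← mul_assoc, div_mul_cancel₀ _ hlog]
        push_cast
        rfl
      rw [tendsto_zero_iff_norm_tendsto_zero] at h1 ⊢
      refine h1.congr fun M => ?_
      simp only [hF]
      rw [norm_mul, hE1, one_mul]
  have hev : (fun M => ∫ ω, F M (phrase (𝒟 M) fun i => ξ i ω) ∂μ) =ᶠ[atTop]
      fun M => 1 - (∫ ω, E M (phrase (𝒟 M) fun i => ξ i ω) ∂μ) * Complex.exp v := by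
    filter_upwards [eventually_ge_atTop 1, hφ1.eventually_ne one_ne_zero] with M hM hM0
    rw [hξ.integral_comp_phrase hp₀ hp₁ (h𝒟 M hM) (F M),
      hξ.integral_comp_phrase hp₀ hp₁ (h𝒟 M hM) (E M), ← (h M hM).grows.sum_exp hM0,
      Finset.sum_mul, ← Finset.sum_sub_distrib]
    refine Finset.sum_congr rfl fun w _ => ?_
    simp only [hF, hE, hφ, Complex.real_smul]
    ring
  have h5 := ((tendsto_const_nhds (x := (1 : ℂ))).sub (hF0.congr' hev)).mul_const
    (Complex.exp (-(v : ℂ)))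
  rw [sub_zero, one_mul] at h5
  refine h5.congr fun M => ?_
  rw [sub_sub_cancel, mul_assoc, ← Complex.exp_add, add_neg_cancel, Complex.exp_zero, mul_one]

theorem tendsto_integral_exp_phraseLength (hξ : IsMemorylessSource μ p ξ) (hp₀ : 0 < p)
    (hp₁ : p < 1) (h𝒟 : ∀ M, 1 ≤ M → IsTunstallCode p M (𝒟 M))
    (h : ∀ M, 1 ≤ M → IsKhodak p M (𝒟 M) (I M) (t M)) (v : ℝ) :
    Tendsto (fun M : ℕ => ∫ ω, Complex.exp ((v * ((phraseLength (𝒟 M) (fun i => ξ i ω) -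
      Real.log M / entropy p) / √(Real.log M)) : ℝ) * Complex.I) ∂μ) atTop
      (𝓝 (Complex.exp (-(sigmaSq p / entropy p ^ 3 * v ^ 2 / 2 : ℝ)))) := by
  have hH := entropy_pos hp₀ hp₁
  set H := entropy p
  set c := letterCost p true + letterCost p false
  -- Since the cost is `ln M + O(1)`, length minus `ln M / H` equals `-1/H` times (cost - `H`
  -- length) up to `O(1)`, which disappears after division by `√(ln M)`.
  have h1 := hξ.tendsto_integral_exp_wordCost_sub hp₀ hp₁ h𝒟 h (-v / H)
  rw [show sigmaSq p * (-v / H) ^ 2 / (2 * H) = sigmaSq p / H ^ 3 * v ^ 2 / 2 by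
    field_simp] at h1
  have hb : Tendsto (fun M : ℕ => |v| / H * c / √(Real.log M)) atTop (𝓝 0) :=
    (Real.tendsto_sqrt_atTop.comp tendsto_log_natCast).const_div_atTop _
  refine h1.congr_dist (squeeze_zero' (.of_forall fun _ => dist_nonneg) ?_ hb)
  filter_upwards [eventually_ge_atTop 2] with M hM
  have hM1 : 1 ≤ M := by omega
  have hlog : 0 < Real.log M := Real.log_pos (by exact_mod_cast hM)
  have hsq : 0 < √(Real.log M) := Real.sqrt_pos.2 hlog
  set A : List Bool → ℂ := fun w => Complex.exp ((-v / H / √(Real.log M) *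
    (wordCost p w - H * w.length) : ℝ) * Complex.I) with hA
  set B : List Bool → ℂ := fun w => Complex.exp ((v * ((w.length - Real.log M / H) /
    √(Real.log M)) : ℝ) * Complex.I) with hB
  have hint : ∀ G : List Bool → ℂ, (∀ w, ‖G w‖ = 1) →
      Integrable (fun ω => G (phrase (𝒟 M) fun i => ξ i ω)) μ := fun G hG =>
    Integrable.of_bound (hξ.measurable_comp_phrase (h𝒟 M hM1) G).aestronglyMeasurable 1
      (.of_forall fun ω => (hG _).le)
  have key : ∀ w ∈ 𝒟 M, ‖A w - B w‖ ≤ |v| / H * c / √(Real.log M) := by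
    intro w hw
    have hw' := (h M hM1).abs_wordCost_sub_log_le hp₀ hp₁ hw
    set x := -v / H / √(Real.log M) * (wordCost p w - H * w.length) with hx
    set y := v * ((w.length - Real.log M / H) / √(Real.log M)) with hy
    have e : A w - B w = B w * (Complex.exp (Complex.I * (x - y : ℝ)) - 1) := by
      simp only [hA, hB, ← hx, ← hy]
      rw [mul_sub, ← Complex.exp_add, mul_one]
      congr 2
      push_cast; ring
    have hxy : x - y = -(v / H / √(Real.log M)) * (wordCost p w - Real.log M) := by
      rw [hx, hy]; field_simp; ring
    rw [e, norm_mul, hB, Complex.norm_exp_ofReal_mul_I, one_mul]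
    refine Real.norm_exp_I_mul_ofReal_sub_one_le.trans ?_
    rw [hxy, Real.norm_eq_abs, abs_mul, abs_neg, abs_div, abs_div, abs_of_pos hH, abs_of_pos hsq]
    rw [mul_div_right_comm]
    gcongr
  have hBeq : ∀ ω, Complex.exp ((v * ((phraseLength (𝒟 M) (fun i => ξ i ω) -
      Real.log M / H) / √(Real.log M)) : ℝ) * Complex.I) = B (phrase (𝒟 M) fun i => ξ i ω) := by
    intro ω
    simp only [hB, length_phrase]
  simp_rw [hBeq]
  rw [dist_eq_norm]
  change ‖(∫ ω, A (phrase (𝒟 M) fun i => ξ i ω) ∂μ) - _‖ ≤ _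
  rw [← integral_sub (hint A fun w => Complex.norm_exp_ofReal_mul_I _)
    (hint B fun w => Complex.norm_exp_ofReal_mul_I _)]
  have := norm_integral_le_of_norm_le_const (μ := μ) (f := fun ω =>
    A (phrase (𝒟 M) fun i => ξ i ω) - B (phrase (𝒟 M) fun i => ξ i ω))
    (.of_forall fun ω => key _ ((h𝒟 M hM1).phrase_mem _))
  simpa using this

end IsMemorylessSource

/-- Lévy's continuity theorem for convergence in distribution to a centred normal law. -/
theorem tendstoInDistribution_gaussianReal {Ω : Type*} [MeasurableSpace Ω] {μ : Measure Ω}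
    [IsProbabilityMeasure μ] {Z : ℕ → Ω → ℝ} (hZ : ∀ M, AEMeasurable (Z M) μ) {s : ℝ}
    (hs : 0 ≤ s) (h : ∀ v : ℝ, Tendsto (fun M => ∫ ω, Complex.exp ((v * Z M ω : ℝ) * Complex.I) ∂μ)
      atTop (𝓝 (Complex.exp (-(s * v ^ 2 / 2 : ℝ))))) :
    TendstoInDistribution Z atTop (id : ℝ → ℝ) (fun _ => μ) (gaussianReal 0 s.toNNReal) where
  forall_aemeasurable := hZ
  aemeasurable_limit := aemeasurable_id
  tendsto := by
    refine ProbabilityMeasure.tendsto_iff_tendsto_charFun.2 fun v => ?_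
    have e : ∀ M, charFun (μ.map (Z M)) v =
        ∫ ω, Complex.exp ((v * Z M ω : ℝ) * Complex.I) ∂μ := fun M => by
      rw [charFun_apply_real, integral_map (hZ M) (by fun_prop)]
      simp
    have e' : charFun ((gaussianReal 0 s.toNNReal).map id) v =
        Complex.exp (-(s * v ^ 2 / 2 : ℝ)) := by
      rw [Measure.map_id, charFun_gaussianReal, Real.coe_toNNReal _ hs]
      simp
    change Tendsto (fun M => charFun (μ.map (Z M)) v) atTop
      (𝓝 (charFun ((gaussianReal 0 s.toNNReal).map id) v))
    simp_rw [e, e']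
    exact h v

theorem sigmaSq_pos {p : ℝ} (hp₀ : 0 < p) (hp₁ : p < 1) (hp : p ≠ 1 / 2) : 0 < sigmaSq p := by
  have hq := sub_pos.2 hp₁
  have hlog : Real.log (p / (1 - p)) ≠ 0 := by
    refine Real.log_ne_zero_of_pos_of_ne_one (by positivity) fun h1 => hp ?_
    rw [div_eq_one_iff_eq hq.ne'] at h1
    linarith
  rw [sigmaSq_eq hp₀ hp₁]
  positivity

end

end Tunstall

/-- Let `ξ 0, ξ 1, …` be the letters of a random string, i.i.d. with `P(ξ i = 1) = p`, let `𝒟 M`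
be, for each `M ≥ 1`, any Tunstall code with `M` phrases, and let `L M` be the length of the first
phrase of the random string. -/
theorem mainTheorem6 {Ω : Type*} [MeasurableSpace Ω] (μ : Measure Ω) [IsProbabilityMeasure μ]
    (p : ℝ) (hp₀ : 0 < p) (hp₁ : p < 1)
    (ξ : ℕ → Ω → Bool) (hξ_meas : ∀ i, Measurable (ξ i)) (hξ_indep : iIndepFun ξ μ)
    (hξ_law : ∀ i, μ {ω | ξ i ω = true} = ENNReal.ofReal p)
    (𝒟 : ℕ → Finset (List Bool)) (h𝒟 : ∀ M, 1 ≤ M → IsTunstallCode p M (𝒟 M))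
    (L : ℕ → Ω → ℝ) (hL : ∀ M ω, L M ω = phraseLength (𝒟 M) (fun i => ξ i ω))
    (H H₂ σsq d : ℝ) (hH : H = entropy p) (hH₂ : H₂ = entropy₂ p) (hσsq : σsq = sigmaSq p)
    (hd : d = Tunstall.span p) :
    -- almost sure convergence
    (∀ᵐ ω ∂μ, Tendsto (fun M : ℕ => L M ω / Real.log M) atTop (𝓝 (1 / H))) ∧
    -- asymptotic normality (the limit is the point mass at `0` if `p = 1/2`)
    TendstoInDistribution
      (fun (M : ℕ) ω => (L M ω - Real.log M / H) / √(Real.log M)) atTop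
      (id : ℝ → ℝ) (fun _ => μ) (gaussianReal 0 (σsq / H ^ 3).toNNReal) ∧
    (p ≠ 1 / 2 → TendstoInDistribution
      (fun (M : ℕ) ω => (L M ω - Real.log M / H) / √(σsq / H ^ 3 * Real.log M)) atTop
      (id : ℝ → ℝ) (fun _ => μ) (gaussianReal 0 1)) ∧
    -- variance
    ((fun M : ℕ => Var[L M; μ] - σsq / H ^ 3 * Real.log M) =o[atTop]
      fun M : ℕ => Real.log M) ∧
    (p ≠ 1 / 2 → (fun M : ℕ => Var[L M; μ]) ~[atTop] fun M : ℕ => σsq / H ^ 3 * Real.log M) ∧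
    -- expectation, irrational case
    (Irrational (Real.log p / Real.log (1 - p)) →
      (fun M : ℕ => (∫ ω, L M ω ∂μ) - (Real.log M / H + Real.log H / H + H₂ / (2 * H ^ 2)))
        =o[atTop] fun _ => (1 : ℝ)) ∧
    -- expectation, rational case
    (¬ Irrational (Real.log p / Real.log (1 - p)) →
      (fun M : ℕ => (∫ ω, L M ω ∂μ) -
        (Real.log M / H + Real.log H / H + H₂ / (2 * H ^ 2)
          + 1 / H * Real.log (Real.sinh (d / 2) / (d / 2))
          + d / H * psi d (Int.fract
              ((Real.log M + Real.log (H * (1 - Real.exp (-d)) / d)) / d))))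
        =o[atTop] fun _ => (1 : ℝ)) := by
  have hξ : IsMemorylessSource μ p ξ := ⟨hξ_meas, hξ_indep, hξ_law⟩
  choose I t hK using fun M (hM : 1 ≤ M) => (h𝒟 M hM).exists_isKhodak hp₀ hp₁
  -- Nothing is assumed about `𝒟 0`, so the values at `M = 0` are arbitrary placeholders.
  obtain ⟨I', t', hK⟩ : ∃ (I' : ℕ → Finset (List Bool)) (t' : ℕ → ℝ), ∀ M, 1 ≤ M →
      IsKhodak p M (𝒟 M) (I' M) (t' M) :=
    ⟨fun M => if hM : 1 ≤ M then I M hM else ∅, fun M => if hM : 1 ≤ M then t M hM else 0,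
      fun M hM => by simpa only [dif_pos hM] using hK M hM⟩
  obtain rfl : L = fun M ω => (phraseLength (𝒟 M) (fun i => ξ i ω) : ℝ) :=
    funext fun M => funext fun ω => hL M ω
  have hHpos : 0 < H := hH ▸ entropy_pos hp₀ hp₁
  have hσ : 0 ≤ σsq := hσsq ▸ sigmaSq_nonneg hp₀ hp₁
  have hmeanvar := fun M (hM : 1 ≤ M) => hξ.variance_phraseLength hp₀ hp₁ (h𝒟 M hM)
  have hchar := hξ.tendsto_integral_exp_phraseLength hp₀ hp₁ h𝒟 hK
  have hvar := isLittleO_codeVar hp₀ hp₁ hK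
  rw [← hH, ← hσsq] at hvar
  simp_rw [← hH, ← hσsq] at hchar
  have hmeas : ∀ M, 1 ≤ M →
      Measurable fun ω => (phraseLength (𝒟 M) (fun i => ξ i ω) : ℝ) := fun M hM => by
    simpa only [length_phrase] using
      hξ.measurable_comp_phrase (h𝒟 M hM) (fun w => (w.length : ℝ))
  have hvar' : (fun M : ℕ => Var[fun ω => (phraseLength (𝒟 M) (fun i => ξ i ω) : ℝ); μ] -
      σsq / H ^ 3 * Real.log M) =o[atTop] fun M : ℕ => Real.log M := by
    refine hvar.congr' ?_ .rfl
    filter_upwards [eventually_ge_atTop 1] with M hM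
    rw [(hmeanvar M hM).2]
  refine ⟨?_, ?_, fun hp => ?_, hvar', fun hp => ?_, fun hirr => ?_, fun hrat => ?_⟩
  · rw [hH]
    exact hξ.tendsto_length_div_log hp₀ hp₁ h𝒟 hK
  · refine tendstoInDistribution_gaussianReal (fun M => ?_) (by positivity) hchar
    -- At `M = 0` the denominator is `√(log 0) = 0`, so the variable is identically `0` and
    -- measurable whatever `𝒟 0` is.
    rcases Nat.eq_zero_or_pos M with rfl | hM
    · simp
    · exact (((hmeas M hM).sub_const _).div_const _).aemeasurable
  · have hs : 0 < σsq / H ^ 3 := by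
      have := hσsq ▸ sigmaSq_pos hp₀ hp₁ hp
      positivity
    have hs' : 0 < √(σsq / H ^ 3) := Real.sqrt_pos.2 hs
    have := tendstoInDistribution_gaussianReal (μ := μ) (s := 1) (Z := fun (M : ℕ) ω =>
      ((phraseLength (𝒟 M) (fun i => ξ i ω) : ℝ) - Real.log M / H) /
        √(σsq / H ^ 3 * Real.log M)) (fun M => ?_) zero_le_one fun v => ?_
    · rwa [Real.toNNReal_one] at this
    · rcases Nat.eq_zero_or_pos M with rfl | hM
      · simp
      · exact (((hmeas M hM).sub_const _).div_const _).aemeasurable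
    -- Rescaling the argument normalises the limiting variance to `1`.
    · have h1 := hchar (v / √(σsq / H ^ 3))
      rw [div_pow, Real.sq_sqrt hs.le, mul_div_cancel₀ _ hs.ne'] at h1
      rw [one_mul]
      refine h1.congr fun M => integral_congr_ae (.of_forall fun ω => ?_)
      simp only
      rw [Real.sqrt_mul hs.le]
      congr 3
      field_simp
  · have hs : σsq / H ^ 3 ≠ 0 := by
      have := hσsq ▸ sigmaSq_pos hp₀ hp₁ hp
      positivity
    exact hvar'.const_mul_right hs
  · rw [isLittleO_one_iff, hH, hH₂]
    refine (tendsto_codeMean_of_irrational hp₀ hp₁ hK hirr).congr' ?_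
    filter_upwards [eventually_ge_atTop 1] with M hM
    rw [(hmeanvar M hM).1]
  · rw [isLittleO_one_iff, hH₂]
    refine (tendsto_codeMean_of_not_irrational hp₀ hp₁ hK hrat hH hd).congr' ?_
    filter_upwards [eventually_ge_atTop 1] with M hM
    rw [(hmeanvar M hM).1]
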